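/- Conventions. A (monoid) generating set of a group $G$ is a set $X$ with a surjective monoid homomorphism $\pi\colon X^*\to G$. For $C\le G$, a positive cone relative to $C$ is a subsemigroup $P\subseteq G$ with $G=P\sqcup C\sqcup P^{-1}$; a left-order $\prec$ on $G$ is a total order invariant under left multiplication, with positive cone $P_\prec=\{g: 1\prec g\}$. For a class $\mathcal C$ of languages, $\prec$ is a $\mathcal C$-left-order with respect to a finite generating set $(X,\pi)$ if $\pi(\mathcal L)=P_\prec$ for some language $\mathcal L\subseteq X^*$ in $\mathcal C$. A language is one-counter if it is accepted (by final state) by a nondeterministic pushdown automaton whose stack alphabet has exactly one letter (moves depend on whether the stack is empty). An ordering quasi-morphism with kernel $C$ is a map $\tau\colon G\to\mathbb Z$ such that $|\tau(g)+\tau(h)-\tau(gh)|$ is bounded, $\{g:\tau(g)=0\}=C$ is a subgroup, $\tau(g)=-\tau(g^{-1})$, and $\tau(g)+\tau(h)+\tau((gh)^{-1})\le 1$ for all $g,h\in G$. A rational transducer $\mathbb T$ is a nondeterministic finite automaton (with $\epsilon$-moves) that writes a word on each move; $\mathbb T(w)$ is the set of outputs of accepting runs on $w$, and $\mathbb T^{-1}(\mathcal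 L)=\{w:\mathbb T(w)\cap\mathcal L\ne\emptyset\}$. Given a finite generating set $(X,\pi)$ of $G$, a $\tau$-transducer is a rational transducer with input alphabet $X$ and output alphabet $\{t,t^{-1}\}$ such that the words $w$ with $\mathbb T(w)\neq\emptyset$ represent all elements of $G$, and every $v\in\mathbb T(w)$ satisfies $\sharp_t(v)-\sharp_{t^{-1}}(v)=\tau(\pi(w))$. Put $\mathcal L_{>0}=\{v\in\{t,t^{-1}\}^*:\sharp_t(v)>\sharp_{t^{-1}}(v)\}$. (1) Let $I$ be a finite set, let $G_i$ ($i\in I$) be groups with finite generating sets $(X_i,\pi_i)$ and with a common subgroup $C$ with finite generating set $(Y,\pi_C)$, and let $G$ be the free product of the $G_i$ amalgamated over $C$, with the generating set $X=Y\sqcup\bigsqcup_i X_i$ and the induced evaluation $\pi$. For each $i$ let $P_i$ be a positive cone of $G_i$ relative to $C$, and let $\mathcal L_i\subseteq X_i^*$ be a regular language with $\pi_i(\mathcal L_i)=P_i$. Then there is an ordering quasi-morphism $\tau\colon G\to (2\mathbb Z+1)\cup\{0\}$ with kernel $C$, there are regular languages $\mathcal L_i^-\subseteq X_i^*$ with $\pi_i(\mathcal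 L_i^-)=P_i^{-1}$, and there is a $\tau$-transducer $\mathbb T$ such that $\pi(\mathbb T^{-1}(\mathcal L_{>0}))$ is a positive cone of $G$ relative to $C$ and $$\mathbb T^{-1}(\mathcal L_{>0})=\{w=w_1\cdots w_m z : m\ge 0,\ w_j\in\mathcal L_{i_j}\cup\mathcal L_{i_j}^-,\ i_j\in I,\ i_j\ne i_{j+1},\ z\in Y^*,\ \tau(\pi(w))>0\}.$$ (2) Let $A$ and $B$ be groups that admit regular left-orders with respect to finite generating sets $X$ and $Y$. Then there is an ordering quasi-morphism $\tau\colon A*B\to(2\mathbb Z+1)\cup\{0\}$ with trivial kernel, and a $\tau$-transducer $\mathbb T$ over the generating set $X\sqcup Y$ of $A*B$, such that the language $\mathbb T^{-1}(\mathcal L_{>0})$ is one-counter and evaluates onto $\{g:\tau(g)>0\}$. Moreover $\{g:\tau(g)>0\}$ is the positive cone of a left-order on $A*B$, which is a one-counter left-order with respect to every finite generating set of $A*B$. In particular $A*B$ admits a one-counter left-order. -/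

import Mathlib

namespace LeftOrderLang

/-! ### Pushdown automata and one-counter languages -/

/-- A nondeterministic pushdown automaton with states `S`, input alphabet `X` and stack alphabet
`Γ`. `none : Option X` is the empty input, `none : Option Γ` stands for the empty stack. The top of
the stack is the last letter of the stack word. -/
structure PDA (S X Γ : Type*) where
  step : S → Option X → Option Γ → Finset (S × List Γ)
  start : S
  initStack : List Γ
  accept : Set S

namespace PDA

variable {S X Γ : Type*} (M : PDA S X Γ)

/-- One move with input `x`: the last stack letter `σ` (if the stack is non-empty) is deleted, and a
word `u` allowed by the transition function on `σ` is appended. On the empty stack the move is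
governed by the value of the transition function at `none`. -/
def Move (x : Option X) (c c' : S × List Γ) : Prop :=
  ∃ u : List Γ, (c'.1, u) ∈ M.step c.1 x c.2.getLast? ∧ c'.2 = c.2.dropLast ++ u

/-- `M.Run c w c'`: there is a sequence of moves from the configuration `c` to `c'` that reads the
word `w`; moves with empty input may occur anywhere. -/
inductive Run : S × List Γ → List X → S × List Γ → Prop
  | refl (c : S × List Γ) : Run c [] c
  | move {c c' c'' : S × List Γ} {x : Option X} {w : List X} :
      M.Move x c c' → Run c' w c'' → Run c (x.toList ++ w) c''

/-- The language accepted by final state. -/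
def accepts : Language X :=
  {w | ∃ c : S × List Γ, c.1 ∈ M.accept ∧ M.Run (M.start, M.initStack) w c}

end PDA

/-- A language is one-counter if it is accepted by a pushdown automaton with finitely many states
and a stack alphabet with exactly one letter. -/
def IsOneCounter {X : Type*} (L : Language X) : Prop :=
  ∃ (S Γ : Type) (_ : Finite S) (_ : Nat.card Γ = 1) (M : PDA S X Γ), M.accepts = L

/-! ### Rational transducers -/

/-- A transducer with states `S`, input alphabet `X` and output alphabet `Y`; `none : Option X` is
the empty input. -/
structure Transducer (S X Y : Type*) where
  step : S → Option X → Finset (S × List Y)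
  start : S
  accept : Set S

namespace Transducer

variable {S X Y : Type*} (T : Transducer S X Y)

/-- `T.Run s w s' v`: the transducer can go from `s` to `s'` reading `w` and writing `v`. -/
inductive Run : S → List X → S → List Y → Prop
  | refl (s : S) : Run s [] s []
  | move {s s' s'' : S} {x : Option X} {w : List X} {u v : List Y} :
      (s', u) ∈ T.step s x → Run s' w s'' v → Run s (x.toList ++ w) s'' (u ++ v)

/-- The set `T(w)` of outputs on the input word `w`. -/
def outputs (w : List X) : Language Y :=
  {v | ∃ s ∈ T.accept, T.Run T.start w s v}

/-- The inverse image of a language under `T`. -/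
def preimage (L : Language Y) : Language X :=
  {w | ∃ v ∈ L, v ∈ T.outputs w}

end Transducer

/-! ### Generating sets, positive cones and left-orders -/

variable {G : Type*} [Group G] {X : Type*}

/-- The monoid homomorphism from words over `X` to `G` determined by its values on letters. -/
def eval (p : X → G) (w : List X) : G := (w.map p).prod

/-- `(X, p)` is a monoid generating set of `G`. -/
def IsGenerating (p : X → G) : Prop := Function.Surjective (eval p)

/-- `P` is a subsemigroup of `G`, and `G` is the disjoint union of `P`, `C` and `P⁻¹`. -/
structure IsRelPositiveCone (C : Subgroup G) (P : Set G) : Prop where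
  mul_mem : ∀ g ∈ P, ∀ h ∈ P, g * h ∈ P
  cover : ∀ g, g ∈ P ∨ g ∈ C ∨ g⁻¹ ∈ P
  disjoint_left : ∀ g ∈ P, g ∉ C
  disjoint_inv : ∀ g ∈ P, g⁻¹ ∉ P

/-- `lt` is (the strict part of) a left-order: a strict total order that is invariant under left
multiplication. -/
structure IsLeftOrder (lt : G → G → Prop) : Prop where
  irrefl : ∀ a, ¬ lt a a
  trans : ∀ a b c, lt a b → lt b c → lt a c
  total : ∀ a b, lt a b ∨ a = b ∨ lt b a
  mul_left : ∀ a b c, lt a b ↔ lt (c * a) (c * b)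

/-- The positive cone of a left-order. -/
def positiveCone (lt : G → G → Prop) : Set G := {g | lt 1 g}

/-- `lt` is a `𝒞`-left-order with respect to the generating set `(X, p)`: its positive cone is the
evaluation of a language over `X` in the class `𝒞`. -/
def IsLeftOrderOfClass (𝒞 : Language X → Prop) (p : X → G) (lt : G → G → Prop) : Prop :=
  IsLeftOrder lt ∧ ∃ L : Language X, 𝒞 L ∧ eval p '' {w | w ∈ L} = positiveCone lt

/-! ### Ordering quasi-morphisms and their transducers -/

/-- `τ` is an ordering quasi-morphism with kernel `C`. -/
structure IsOrderingQuasimorphism (τ : G → ℤ) (C : Subgroup G) : Prop where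
  quasi : ∃ D : ℤ, ∀ g h, |τ g + τ h - τ (g * h)| ≤ D
  kernel : ∀ g, τ g = 0 ↔ g ∈ C
  inv : ∀ g, τ g = -τ g⁻¹
  le_one : ∀ g h, τ g + τ h + τ (g * h)⁻¹ ≤ 1

/-- The evaluation of words over `{t, t⁻¹}` in `ℤ`; `t` is `true` and `t⁻¹` is `false`. -/
def evalInt (v : List Bool) : ℤ := (v.map fun b => if b then (1 : ℤ) else -1).sum

/-- The words over `{t, t⁻¹}` in which `t` occurs more often than `t⁻¹`. -/
def posWords : Language Bool := {v | v.count false < v.count true}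

/-- `T` is a `τ`-transducer with respect to the generating set `(X, p)`: the words on which `T` has
an output represent all elements of `G`, and every output of `T` on `w` evaluates to the value of
`τ` at the element represented by `w`. -/
structure IsTauTransducer {S : Type*} (T : Transducer S X Bool) (p : X → G) (τ : G → ℤ) :
    Prop where
  surj : ∀ g, ∃ w, (∃ v, v ∈ T.outputs w) ∧ eval p w = g
  compute : ∀ w v, v ∈ T.outputs w → τ (eval p w) = evalInt v

/-! ### Generating sets and words of free products -/

/-- The generating set `Y ⊔ ⨆ X i` of the amalgamated free product of the `G i` over `H`. -/
def amalgamGens {ι H Y : Type*} {G X : ι → Type*} [∀ i, Group (G i)] [Group H]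
    (φ : ∀ i, H →* G i) (p : ∀ i, X i → G i) (q : Y → H) :
    Y ⊕ (Σ i, X i) → Monoid.PushoutI φ :=
  Sum.elim (fun y => Monoid.PushoutI.base φ (q y)) (fun x => Monoid.PushoutI.of x.1 (p x.1 x.2))

/-- The generating set `X ⊔ Y` of the free product of `A` and `B`. -/
def coprodGens {A B X Y : Type*} [Group A] [Group B] (p : X → A) (q : Y → B) :
    X ⊕ Y → Monoid.Coprod A B :=
  Sum.elim (fun x => Monoid.Coprod.inl (p x)) (fun y => Monoid.Coprod.inr (q y))

/-- The words `w₁ ⋯ wₘ z` where `wⱼ` is a word over `X iⱼ` in `Lp iⱼ ∪ Lm iⱼ`, consecutive indices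
`iⱼ` are distinct, and `z` is any word over `Y`. -/
def syllableWords {ι Y : Type*} {X : ι → Type*} (Lp Lm : ∀ i, Language (X i)) :
    Language (Y ⊕ (Σ i, X i)) :=
  {w | ∃ (l : List (Σ i, List (X i))) (z : List Y),
    l.IsChain (fun a b => a.1 ≠ b.1) ∧ (∀ a ∈ l, a.2 ∈ Lp a.1 ∨ a.2 ∈ Lm a.1) ∧
    w = (l.flatMap fun a => a.2.map fun x => Sum.inr ⟨a.1, x⟩) ++ z.map Sum.inl}

end LeftOrderLang

open LeftOrderLang

namespace LeftOrderLang

/-! An element of the amalgam is a reduced product `g₁ ⋯ gₖ c` with `c` in the amalgamated subgroup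
`C`. Order the factors by an injection `n` into `ℕ`, and let `τ` be the sum of the signs of the `gⱼ`
with respect to the relative cones and of the jumps `±1` between consecutive factor indices. For `k
≥ 1` this is a sum of `2k - 1` odd numbers, hence odd, so `τ` vanishes exactly on `C`.

The heart is `exists_inv_syllableProd_mul`. To compute `u⁻¹ w`, the common prefix of `u` and `w`
modulo `C` is cancelled. The sums change in parallel until the first disagreement, which costs at
most `1`: by `abs_coneSign_sub_le` if two syllables of one factor meet there, by `abs_jump_add_le`
if two factors meet. With the normal form theorem this also shows that `τ` does not depend on the
reduced expression. Defect at most `1` and integrality make `{τ > 0}` a semigroup, so it is a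
relative cone.

All ingredients of `τ` are local, so a finite automaton can write them while reading syllables from
`Lᵢ ∪ Lᵢ⁻`; it remembers only the last index and a state of a DFA. The languages `Lᵢ⁻` come from
reversing automata and inverting letters. A counter with a sign decides whether the output is
positive, so the preimage is one-counter. Substituting words for letters keeps the graph finite,
which gives independence of the generating set. A free product of two groups is the amalgam over the
trivial group. -/

/-! ### Finite graphs labelled by words -/

/-- `WordPath E s w t v`: in the graph with edges `E` there is a path from `s` to `t` whose input
labels multiply to `w` and whose output labels multiply to `v`. -/
inductive WordPath {S X Y : Type*} (E : Set (S × List X × List Y × S)) :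
    S → List X → S → List Y → Prop
  | refl (s : S) : WordPath E s [] s []
  | cons {s s' t : S} {u w : List X} {v o : List Y} :
      (s, u, v, s') ∈ E → WordPath E s' w t o → WordPath E s (u ++ w) t (v ++ o)

namespace WordPath

variable {S X Y : Type*} {E : Set (S × List X × List Y × S)}

theorem trans {s t r : S} {w w' : List X} {v v' : List Y} (h : WordPath E s w t v)
    (h' : WordPath E t w' r v') : WordPath E s (w ++ w') r (v ++ v') := by
  induction h with
  | refl => simpa using h'
  | cons he _ ih => simpa [List.append_assoc] using (ih h').cons he

theorem single {s t : S} {u : List X} {v : List Y} (h : (s, u, v, t) ∈ E) :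
    WordPath E s u t v := by
  simpa using (WordPath.refl t).cons h

end WordPath

/-! ### Runs of transducers, renaming of states, and the associated word-labelled graphs. -/

namespace Transducer

theorem Run.trans {S X Y : Type*} {T : Transducer S X Y} {s t r : S} {w w' : List X}
    {v v' : List Y} (h : T.Run s w t v) (h' : T.Run t w' r v') :
    T.Run s (w ++ w') r (v ++ v') := by
  induction h with
  | refl => simpa using h'
  | move he _ ih => simpa [List.append_assoc] using Run.move he (ih h')

theorem Run.single {S X Y : Type*} {T : Transducer S X Y} {s t : S} {x : Option X}
    {v : List Y} (h : (t, v) ∈ T.step s x) : T.Run s x.toList t v := by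
  simpa using Run.move h (.refl t)

/-- Renaming the states of a transducer. -/
def reindex {S S' X Y : Type*} [DecidableEq (S' × List Y)] (e : S ≃ S') (T : Transducer S X Y) :
    Transducer S' X Y where
  step s x := (T.step (e.symm s) x).image fun p => (e p.1, p.2)
  start := e T.start
  accept := {s | e.symm s ∈ T.accept}

theorem run_reindex {S S' X Y : Type*} [DecidableEq (S' × List Y)] (e : S ≃ S')
    (T : Transducer S X Y) {s t : S'} {w : List X} {v : List Y} :
    (T.reindex e).Run s w t v ↔ T.Run (e.symm s) w (e.symm t) v := by
  constructor
  · intro h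
    induction h with
    | refl => exact .refl _
    | move he _ ih =>
      simp only [reindex, Finset.mem_image, Prod.mk.injEq] at he
      obtain ⟨p, hp, rfl, rfl⟩ := he
      exact .move hp (by simpa using ih)
  · intro h
    generalize hs : e.symm s = s₀ at h
    generalize ht : e.symm t = t₀ at h
    obtain rfl := (e.symm_apply_eq.1 hs)
    obtain rfl := (e.symm_apply_eq.1 ht)
    clear hs ht
    induction h with
    | refl => exact .refl _
    | @move a b c x w' u v' he _ ih =>
      refine .move (s' := e b) ?_ ih
      simp only [reindex, Finset.mem_image, Prod.mk.injEq]
      exact ⟨(b, u), by simpa using he, rfl, rfl⟩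

theorem outputs_reindex {S S' X Y : Type*} [DecidableEq (S' × List Y)] (e : S ≃ S')
    (T : Transducer S X Y) (w : List X) : (T.reindex e).outputs w = T.outputs w := by
  ext v
  constructor
  · rintro ⟨s, hs, h⟩
    exact ⟨e.symm s, hs, by simpa [reindex] using (run_reindex e T).1 h⟩
  · rintro ⟨s, hs, h⟩
    exact ⟨e s, by simpa [reindex] using hs, (run_reindex e T).2 (by simpa [reindex] using h)⟩

/-- The edges of a transducer, with the input letters replaced by words. -/
def edges {S X Z Y : Type*} (T : Transducer S X Y) (h : X → List Z) :
    Set (S × List Z × List Y × S) :=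
  {e | ∃ x : Option X, e.2.1 = x.toList.flatMap h ∧ (e.2.2.2, e.2.2.1) ∈ T.step e.1 x}

theorem edges_finite {S X Z Y : Type*} [Finite S] [Finite X] (T : Transducer S X Y)
    (h : X → List Z) : (T.edges h).Finite := by
  have : (⋃ (q : S × Option X), (fun p : S × List Y => (q.1, q.2.toList.flatMap h, p.2, p.1)) ''
      (T.step q.1 q.2 : Set (S × List Y))).Finite :=
    Set.finite_iUnion fun q => (Finset.finite_toSet _).image _
  refine this.subset ?_
  rintro ⟨s, u, v, t⟩ ⟨x, rfl, hx⟩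
  exact Set.mem_iUnion.2 ⟨(s, x), (t, v), hx, rfl⟩

theorem wordPath_edges_iff {S X Z Y : Type*} (T : Transducer S X Y) (h : X → List Z) {s t : S}
    {w : List Z} {v : List Y} :
    WordPath (T.edges h) s w t v ↔ ∃ w', w'.flatMap h = w ∧ T.Run s w' t v := by
  constructor
  · intro hp
    induction hp with
    | refl => exact ⟨[], rfl, .refl _⟩
    | cons he _ ih =>
      obtain ⟨w', rfl, hr⟩ := ih
      obtain ⟨x, hx, hx'⟩ := he
      simp only at hx hx'
      exact ⟨x.toList ++ w', by simp [hx], .move hx' hr⟩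
  · rintro ⟨w', rfl, hr⟩
    induction hr with
    | refl => exact .refl _
    | @move s s' s'' x w u v he _ ih =>
      rw [List.flatMap_append]
      exact .cons ⟨x, rfl, he⟩ ih

end Transducer

/-- The relation given by a finite graph labelled by words is computed by a transducer which in
each move writes at most one letter. -/
theorem exists_transducer_of_wordPath {S X : Type*} [Finite S] [Finite X]
    {E : Set (S × List X × List Bool × S)} (hE : E.Finite) (s₀ : S) (F : Set S) :
    ∃ (Q : Type) (_ : Finite Q) (T : Transducer Q X Bool),
      (∀ q x, ∀ p ∈ T.step q x, p.2.length ≤ 1) ∧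
      ∀ w v, v ∈ T.outputs w ↔ ∃ t ∈ F, WordPath E s₀ w t v := by
  classical
  obtain ⟨K, hK⟩ := (hE.image fun e => max e.2.1.length e.2.2.1.length).bddAbove
  have hK' : ∀ s u v t, (s, u, v, t) ∈ E → u.length ≤ K ∧ v.length ≤ K := by
    intro s u v t h
    exact max_le_iff.1 (hK ⟨_, h, rfl⟩)
  -- A state is a vertex together with the input still to be read and the output still to be written
  -- on the edge just chosen. The bound `K` on edge labels makes these buffers finite in number.
  let A : Set (S × List X × List Bool) := {q | q.2.1.length ≤ K ∧ q.2.2.length ≤ K}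
  have hA : A.Finite := by
    refine (Set.finite_univ.prod ((List.finite_length_le X K).prod
      (List.finite_length_le Bool K))).subset ?_
    rintro ⟨s, u, v⟩ h
    exact ⟨trivial, h.1, h.2⟩
  have : Finite A := hA
  -- Either a piece of the buffers is processed, or, when both are empty, a new edge is loaded by a
  -- silent move.
  let R : A → Option X → A → List Bool → Prop := fun q x q' o =>
    (q.1.1 = q'.1.1 ∧ q.1.2.1 = x.toList ++ q'.1.2.1 ∧ q.1.2.2 = o ++ q'.1.2.2) ∨
    (q.1.2 = ([], []) ∧ x = none ∧ o = [] ∧ (q.1.1, q'.1.2.1, q'.1.2.2, q'.1.1) ∈ E)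
  let T : Transducer A X Bool :=
    { step := fun q x => Set.Finite.toFinset (s := {p | R q x p.1 p.2 ∧ p.2.length ≤ 1})
        ((Set.finite_univ.prod (List.finite_length_le Bool 1)).subset
          fun p hp => ⟨trivial, hp.2⟩)
      start := ⟨(s₀, [], []), Nat.zero_le _, Nat.zero_le _⟩
      accept := {q | q.1.1 ∈ F ∧ q.1.2 = ([], [])} }
  have hstep : ∀ q x p, p ∈ T.step q x ↔ R q x p.1 p.2 ∧ p.2.length ≤ 1 := by
    intro q x p
    simp [T]
  -- For the induction the run may start with loaded buffers; these are then prefixes of what is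
  -- read and written.
  have hrun : ∀ (q q' : A) w o, T.Run q w q' o → q'.1.2 = ([], []) →
      ∃ w' o', w = q.1.2.1 ++ w' ∧ o = q.1.2.2 ++ o' ∧ WordPath E q.1.1 w' q'.1.1 o' := by
    intro q q' w o h hq'
    induction h with
    | refl s => exact ⟨[], [], by simp [hq'], by simp [hq'], .refl _⟩
    | @move a b c x w u v he _ ih =>
      obtain ⟨w', o', rfl, rfl, hp⟩ := ih hq'
      rcases ((hstep _ _ _).1 he).1 with ⟨h1, h2, h3⟩ | ⟨h1, rfl, h2, h3⟩
      · simp only at h1 h2 h3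
        exact ⟨w', o', by simp [h2], by simp [h3], h1 ▸ hp⟩
      · simp only at h2 h3
        subst h2
        exact ⟨_, _, by simp [h1], by simp [h1], .cons h3 hp⟩
  have hread : ∀ (u : List X) (v : List Bool) s (h : (s, u, v) ∈ A),
      T.Run ⟨(s, u, v), h⟩ u ⟨(s, [], v), Nat.zero_le _, h.2⟩ [] := by
    intro u
    induction u with
    | nil => intro v s h; exact .refl _
    | cons a u ih =>
      intro v s h
      have h' : (s, u, v) ∈ A := ⟨(Nat.le_succ _).trans h.1, h.2⟩
      exact Transducer.Run.move (x := some a) (u := []) ((hstep _ _ (⟨_, h'⟩, [])).2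
        ⟨Or.inl ⟨rfl, rfl, rfl⟩, by simp⟩) (ih v s h')
  have hwrite : ∀ (v : List Bool) s (h : (s, [], v) ∈ A),
      T.Run ⟨(s, [], v), h⟩ [] ⟨(s, [], []), Nat.zero_le _, Nat.zero_le _⟩ v := by
    intro v
    induction v with
    | nil => intro s h; exact .refl _
    | cons a v ih =>
      intro s h
      have h' : (s, ([] : List X), v) ∈ A := ⟨h.1, (Nat.le_succ _).trans h.2⟩
      exact Transducer.Run.move (x := none) (u := [a]) ((hstep _ _ (⟨_, h'⟩, [a])).2
        ⟨Or.inl ⟨rfl, rfl, rfl⟩, by simp⟩) (ih s h')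
  have hpath : ∀ s t w o, WordPath E s w t o →
      T.Run ⟨(s, [], []), Nat.zero_le _, Nat.zero_le _⟩ w
        ⟨(t, [], []), Nat.zero_le _, Nat.zero_le _⟩ o := by
    intro s t w o h
    induction h with
    | refl => exact .refl _
    | @cons s s' t u w v o he _ ih =>
      have hb : (s', u, v) ∈ A := hK' _ _ _ _ he
      have h1 := Transducer.Run.single ((hstep ⟨(s, [], []), Nat.zero_le _, Nat.zero_le _⟩ none
        (⟨_, hb⟩, [])).2 ⟨Or.inr ⟨rfl, rfl, rfl, he⟩, by simp⟩)
      simpa using ((h1.trans (hread u v s' hb)).trans (hwrite v s' ⟨Nat.zero_le _, hb.2⟩)).trans ih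
  -- `A` lives in the universes of `S` and `X`; the states have to form a type in `Type`.
  obtain ⟨n, ⟨e⟩⟩ := Finite.exists_equiv_fin A
  refine ⟨Fin n, inferInstance, T.reindex e, ?_, fun w v => ?_⟩
  · intro q x p hp
    simp only [Transducer.reindex, Finset.mem_image] at hp
    obtain ⟨p', hp', rfl⟩ := hp
    exact ((hstep _ _ _).1 hp').2
  · rw [Transducer.outputs_reindex]
    constructor
    · rintro ⟨q, hq, h⟩
      obtain ⟨w', o', rfl, rfl, hp⟩ := hrun _ _ _ _ h hq.2
      exact ⟨q.1.1, hq.1, by simpa [T] using hp⟩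
    · rintro ⟨t, ht, h⟩
      exact ⟨_, ⟨ht, rfl⟩, hpath _ _ _ _ h⟩

/-! ### Domains of transducers are regular -/

/-- Forgetting the outputs leaves an `εNFA` on the same states. -/
theorem Transducer.isRegular_domain {S : Type} {X Y : Type*} [Finite S] (T : Transducer S X Y) :
    Language.IsRegular ({w | ∃ v, v ∈ T.outputs w} : Language X) := by
  classical
  let M : εNFA X S := ⟨fun s x => {s' | ∃ u, (s', u) ∈ T.step s x}, {T.start}, T.accept⟩
  have := Fintype.ofFinite S
  refine ⟨Set S, inferInstance, M.toNFA.toDFA, ?_⟩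
  rw [NFA.toDFA_correct, εNFA.toNFA_correct]
  ext w
  rw [εNFA.mem_accepts_iff_exists_path]
  constructor
  · rintro ⟨s₁, s₂, x', rfl, hs₂, rfl, hp⟩
    suffices ∃ v, T.Run T.start x'.reduceOption s₂ v from
      this.imp fun v hv => ⟨s₂, hs₂, hv⟩
    clear hs₂
    generalize T.start = s at hp
    induction hp with
    | nil => exact ⟨[], .refl _⟩
    | cons t s u a x ht _ ih =>
      obtain ⟨v, hv⟩ := ih
      obtain ⟨o, ho⟩ := ht
      refine ⟨o ++ v, ?_⟩
      convert Transducer.Run.move ho hv using 1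
      cases a <;> simp
  · rintro ⟨v, s₂, hs₂, h⟩
    suffices ∃ x' : List (Option X), x'.reduceOption = w ∧ M.IsPath T.start s₂ x' by
      obtain ⟨x', h1, h2⟩ := this
      exact ⟨_, _, x', rfl, hs₂, h1, h2⟩
    clear hs₂
    generalize T.start = s₁ at h
    induction h with
    | refl => exact ⟨[], rfl, .nil _⟩
    | @move s s' s'' x w u v he _ ih =>
      obtain ⟨x', rfl, hp⟩ := ih
      refine ⟨x :: x', by cases x <;> simp, .cons _ _ _ _ _ ⟨u, he⟩ hp⟩

/-- The inverses of the elements represented by a regular language are represented by a regular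
language. -/
theorem exists_isRegular_inv {G X : Type*} [Group G] [Finite X] {p : X → G} (hp : IsGenerating p)
    {L : Language X} (hL : L.IsRegular) :
    ∃ L' : Language X, L'.IsRegular ∧
      eval p '' {w | w ∈ L'} = {g | g⁻¹ ∈ eval p '' {w | w ∈ L}} := by
  obtain ⟨σ, _, M, rfl⟩ := hL
  choose c hc using fun x => hp (p x)⁻¹
  -- The transitions of `M` are reversed, and the letter `x` becomes a word `c x` for its inverse.
  -- The vertex `none` is a single start leading to all accepting states. Outputs are empty, as only
  -- the domain matters.
  let E : Set (Option σ × List X × List Bool × Option σ) :=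
    Set.range (fun q : M.accept => (none, [], [], some q.1)) ∪
      Set.range (fun e : σ × X => (some (M.step e.1 e.2), c e.2, [], some e.1))
  have hE : E.Finite := (Set.finite_range _).union (Set.finite_range _)
  obtain ⟨Q, _, T, -, hT⟩ := exists_transducer_of_wordPath hE none {some M.start}
  have key : ∀ w v t, WordPath E (some t) w (some M.start) v →
      ∃ u, M.eval u = t ∧ eval p w = (eval p u)⁻¹ := by
    intro w v t h
    generalize hs : some t = s at h
    generalize hf : some M.start = f at h
    induction h generalizing t with
    | refl =>
      subst hf
      exact ⟨[], by simpa using hs.symm, by simp [eval]⟩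
    | cons he _ ih =>
      rcases he with ⟨q, hq⟩ | ⟨⟨q, x⟩, hq⟩
      · simp [← hs] at hq
      · simp only [Prod.mk.injEq, ← hs, Option.some.injEq] at hq
        obtain ⟨rfl, rfl, rfl, h4⟩ := hq
        obtain ⟨u, rfl, hu⟩ := ih q h4 hf
        refine ⟨u ++ [x], by simp, ?_⟩
        have := hc x
        simp only [eval, List.map_append, List.prod_append] at this hu ⊢
        simp [hu, this]
  have key' : ∀ u : List X, ∃ w, WordPath E (some (M.eval u)) w (some M.start) [] ∧
      eval p w = (eval p u)⁻¹ := by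
    intro u
    induction u using List.reverseRecOn with
    | nil => exact ⟨[], .refl _, by simp [eval]⟩
    | append_singleton u x ih =>
      obtain ⟨w, hw, h⟩ := ih
      refine ⟨c x ++ w, ?_, ?_⟩
      · rw [DFA.eval_append_singleton]
        exact WordPath.cons (v := []) (Or.inr ⟨(_, x), rfl⟩) hw
      · have := hc x
        simp only [eval, List.map_append, List.prod_append] at this h ⊢
        simp [h, this]
  refine ⟨_, T.isRegular_domain, ?_⟩
  ext g
  constructor
  · rintro ⟨w, ⟨v, hv⟩, rfl⟩
    obtain ⟨t, rfl, h⟩ := (hT w v).1 hv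
    cases h with
    | cons he h =>
      rcases he with ⟨q, hq⟩ | ⟨⟨q, x⟩, hq⟩
      · simp only [Prod.mk.injEq] at hq
        obtain ⟨-, rfl, -, rfl⟩ := hq
        obtain ⟨u, hu, h⟩ := key _ _ _ h
        exact ⟨u, by simp [DFA.mem_accepts, hu], by simp [h]⟩
      · simp at hq
  · rintro ⟨u, hu, hg⟩
    obtain ⟨w, hw, h⟩ := key' u
    refine ⟨w, ⟨[], (hT w []).2 ⟨_, rfl, ?_⟩⟩, by rw [h, hg, inv_inv]⟩
    exact WordPath.cons (u := []) (v := []) (Or.inl ⟨⟨M.eval u, hu⟩, rfl⟩) hw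

/-! ### Counting -/

theorem evalInt_nil : evalInt [] = 0 := rfl

theorem evalInt_cons (b : Bool) (v : List Bool) :
    evalInt (b :: v) = (if b then 1 else -1) + evalInt v := by
  simp [evalInt]

theorem evalInt_append (u v : List Bool) : evalInt (u ++ v) = evalInt u + evalInt v := by
  simp [evalInt]

theorem mem_posWords_iff (v : List Bool) : v ∈ posWords ↔ 0 < evalInt v := by
  have : evalInt v = v.count true - v.count false := by
    induction v with
    | nil => rfl
    | cons b v ih => cases b <;> simp [evalInt_cons, ih] <;> ring
  rw [this]
  change v.count false < v.count true ↔ _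
  omega

/-- The new sign of the counter and the word pushed on the stack when a word of length at most one
is added to a counter with sign `b` and top letter `σ`. -/
def counterUpdate (b : Bool) (σ : Option Unit) : List Bool → Bool × List Unit
  -- A move of the automaton has already popped `σ`, so keeping it means pushing it back.
  | [] => (b, σ.toList)
  -- With an empty stack both signs stand for `0`, so an opposite letter flips the sign; with a
  -- non-empty stack it cancels the popped letter.
  | c :: _ => if c = b then (b, σ.toList ++ [()]) else if σ = none then (c, [()]) else (b, [])

/-- The integer stored as a sign and a stack. -/
def counterValue (b : Bool) (γ : List Unit) : ℤ := if b then γ.length else -γ.length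

theorem counterValue_update (b : Bool) (γ : List Unit) {u : List Bool} (hu : u.length ≤ 1) :
    counterValue (counterUpdate b γ.getLast? u).1
      (γ.dropLast ++ (counterUpdate b γ.getLast? u).2) = counterValue b γ + evalInt u := by
  rcases List.eq_nil_or_concat γ with rfl | ⟨γ, a, rfl⟩ <;>
  match u, hu with
  | [], _ => cases b <;> simp [counterUpdate, counterValue, evalInt_nil]
  | [c], _ =>
    cases b <;> cases c <;> simp [counterUpdate, counterValue, evalInt] <;> ring

open Classical in
/-- The one-counter automaton recognizing the words with an output of positive value. -/
noncomputable def counterPDA {S X : Type*} (T : Transducer S X Bool) : PDA (Option (S × Bool)) X Unit where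
  step q x σ :=
    match q with
    | none => ∅
    | some (s, b) => ((T.step s x).image fun p =>
          (some (p.1, (counterUpdate b σ p.2).1), (counterUpdate b σ p.2).2)) ∪
        -- Acceptance by final state does not see the stack, so positivity is tested by a silent
        -- move into the extra state `none`, which has no way out.
        (if x = none ∧ σ ≠ none ∧ b = true ∧ s ∈ T.accept then {(none, [])} else ∅)
  start := some (T.start, true)
  initStack := []
  accept := {none}

/-- The value of the counter plus that of the output still to come is invariant under moves, by
`counterValue_update`; hence the arbitrary `b` and `γ`. -/
theorem counterPDA_run_of_run {S X : Type*} {T : Transducer S X Bool}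
    (hT : ∀ s x, ∀ p ∈ T.step s x, p.2.length ≤ 1) {s t : S} {w : List X} {v : List Bool}
    (h : T.Run s w t v) (ht : t ∈ T.accept) (b : Bool) (γ : List Unit)
    (hpos : 0 < counterValue b γ + evalInt v) :
    ∃ c : Option (S × Bool) × List Unit, c.1 = none ∧
      (counterPDA T).Run (some (s, b), γ) w c := by
  induction h generalizing b γ with
  | refl s =>
    refine ⟨(none, γ.dropLast), rfl, ?_⟩
    have hb : b = true := by
      by_contra hb
      simp [counterValue, evalInt_nil, hb] at hpos
      omega
    have hγ : γ ≠ [] := by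
      rintro rfl
      simp [counterValue, evalInt_nil] at hpos
    refine PDA.Run.move (x := none) (w := []) ⟨[], ?_, by simp⟩ (.refl _)
    simp [counterPDA, hb, hγ, ht]
  | @move s s' s'' x w u v he _ ih =>
    have hv := counterValue_update b γ (hT _ _ _ he)
    simp only at hv
    obtain ⟨c, hc, hr⟩ := ih ht (counterUpdate b γ.getLast? u).1
      (γ.dropLast ++ (counterUpdate b γ.getLast? u).2) (by
        rw [hv]; rw [evalInt_append] at hpos; linarith)
    refine ⟨c, hc, .move ⟨(counterUpdate b γ.getLast? u).2, ?_, rfl⟩ hr⟩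
    simp only [counterPDA, Finset.mem_union, Finset.mem_image]
    exact Or.inl ⟨_, he, rfl⟩

theorem run_of_counterPDA_run {S X : Type*} {T : Transducer S X Bool}
    (hT : ∀ s x, ∀ p ∈ T.step s x, p.2.length ≤ 1) {c c' : Option (S × Bool) × List Unit}
    {w : List X} (h : (counterPDA T).Run c w c') (hc' : c'.1 = none) :
    (c.1 = none ∧ w = []) ∨ ∃ s b, c.1 = some (s, b) ∧
      ∃ t ∈ T.accept, ∃ v, T.Run s w t v ∧ 0 < counterValue b c.2 + evalInt v := by
  induction h with
  | refl => exact Or.inl ⟨hc', rfl⟩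
  | @move c d c'' x w hm _ ih =>
    obtain ⟨u, hu, hd⟩ := hm
    rcases c with ⟨_ | ⟨s, b⟩, γ⟩
    · simp [counterPDA] at hu
    refine Or.inr ⟨s, b, rfl, ?_⟩
    simp only [counterPDA, Finset.mem_union, Finset.mem_image, Prod.mk.injEq] at hu
    rcases hu with ⟨⟨s', o⟩, hp, h1, h2⟩ | hu
    · rcases ih hc' with ⟨h3, -⟩ | ⟨s'', b', h3, t, ht, v, hr, hpos⟩
      · simp [← h1] at h3
      · simp only [← h1, Option.some.injEq, Prod.mk.injEq] at h3
        obtain ⟨rfl, rfl⟩ := h3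
        refine ⟨t, ht, o ++ v, .move hp hr, ?_⟩
        have hv := counterValue_update b γ (hT _ _ _ hp)
        simp only at hv h2
        rw [hd, ← h2, hv] at hpos
        rw [evalInt_append]
        simpa [add_assoc] using hpos
    · split_ifs at hu with hif
      · obtain ⟨rfl, hσ, rfl, hs⟩ := hif
        simp only [Finset.mem_singleton, Prod.mk.injEq] at hu
        rcases ih hc' with ⟨h3, rfl⟩ | ⟨s'', b', h3, -⟩
        · refine ⟨s, hs, [], by simpa using Transducer.Run.refl s, ?_⟩
          have hγ : γ ≠ [] := by
            rintro rfl
            simp at hσ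
          simpa [counterValue, evalInt_nil] using List.length_pos_iff.2 hγ
        · simp [hu.1] at h3
      · simp at hu

/-- The words for which a finite graph labelled by words has an output of positive value form a
one-counter language. -/
theorem isOneCounter_wordPath {S X : Type*} [Finite S] [Finite X]
    {E : Set (S × List X × List Bool × S)} (hE : E.Finite) (s₀ : S) (F : Set S) :
    IsOneCounter ({w | ∃ v ∈ posWords, ∃ t ∈ F, WordPath E s₀ w t v} : Language X) := by
  obtain ⟨Q, _, T, hT, hTE⟩ := exists_transducer_of_wordPath hE s₀ F
  refine ⟨Option (Q × Bool), Unit, inferInstance, by simp, counterPDA T, ?_⟩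
  ext w
  constructor
  · rintro ⟨c, hc, h⟩
    rcases run_of_counterPDA_run hT h hc with ⟨h1, -⟩ | ⟨s, b, h1, t, ht, v, hr, hpos⟩
    · simp [counterPDA] at h1
    · simp only [counterPDA, Option.some.injEq, Prod.mk.injEq] at h1
      obtain ⟨rfl, rfl⟩ := h1
      exact ⟨v, (mem_posWords_iff v).2 (by simpa [counterValue, counterPDA] using hpos),
        (hTE w v).1 ⟨t, ht, hr⟩⟩
  · rintro ⟨v, hv, h⟩
    obtain ⟨t, ht, hr⟩ := (hTE w v).2 h
    obtain ⟨c, hc, h⟩ := counterPDA_run_of_run hT hr ht true []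
      (by simpa [counterValue] using (mem_posWords_iff v).1 hv)
    exact ⟨c, hc, h⟩

/-- Relabelling each edge by the substituted word gives another finite graph, to which
`isOneCounter_wordPath` applies. This serves to change the generating set. -/
theorem Transducer.isOneCounter_preimage_posWords_image {S X Z : Type*} [Finite S] [Finite X]
    [Finite Z] (T : Transducer S X Bool) (h : X → List Z) :
    IsOneCounter ({w | ∃ w' ∈ T.preimage posWords, w'.flatMap h = w} : Language Z) := by
  have key : ({w | ∃ w' ∈ T.preimage posWords, w'.flatMap h = w} : Language Z) =
      {w | ∃ v ∈ posWords, ∃ t ∈ T.accept, WordPath (T.edges h) T.start w t v} := by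
    ext w
    constructor
    · rintro ⟨w', ⟨v, hv, t, ht, hr⟩, rfl⟩
      exact ⟨v, hv, t, ht, (T.wordPath_edges_iff h).2 ⟨w', rfl, hr⟩⟩
    · rintro ⟨v, hv, t, ht, hp⟩
      obtain ⟨w', rfl, hr⟩ := (T.wordPath_edges_iff h).1 hp
      exact ⟨w', ⟨v, hv, t, ht, hr⟩, rfl⟩
  rw [key]
  exact isOneCounter_wordPath (T.edges_finite h) T.start T.accept

theorem Transducer.isOneCounter_preimage_posWords {S X : Type*} [Finite S] [Finite X]
    (T : Transducer S X Bool) : IsOneCounter (T.preimage posWords) := by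
  have key : T.preimage posWords =
      {w | ∃ w' ∈ T.preimage posWords, w'.flatMap (fun x => [x]) = w} := by
    ext w
    constructor
    · exact fun h => ⟨w, h, by simp⟩
    · rintro ⟨w', h, h'⟩
      simp at h'
      exact h' ▸ h
  rw [key]
  exact T.isOneCounter_preimage_posWords_image _

/-! ### Signs and jumps -/

open Classical in
/-- The sign of `g` with respect to a relative positive cone. -/
noncomputable def coneSign {G : Type*} [Group G] (P : Set G) (g : G) : ℤ :=
  if g ∈ P then 1 else if g⁻¹ ∈ P then -1 else 0

theorem coneSign_of_mem {G : Type*} [Group G] {P : Set G} {g : G} (hg : g ∈ P) :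
    coneSign P g = 1 := if_pos hg

namespace IsRelPositiveCone

variable {G : Type*} [Group G] {C : Subgroup G} {P : Set G} (hP : IsRelPositiveCone C P)
include hP

/-- If `(g * c)⁻¹` were positive, multiplying it by `g` would put `c⁻¹` into `P`. Together with the
left version, `P` is a union of double cosets of `C`. -/
theorem mul_mem_right {g c : G} (hg : g ∈ P) (hc : c ∈ C) : g * c ∈ P := by
  rcases hP.cover (g * c) with h | h | h
  · exact h
  · exact absurd ((C.mul_mem_cancel_right hc).1 h) (hP.disjoint_left g hg)
  · have := hP.mul_mem _ h _ hg
    refine absurd (C.inv_mem hc) (hP.disjoint_left _ ?_)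
    simpa using this

theorem mul_mem_left {g c : G} (hg : g ∈ P) (hc : c ∈ C) : c * g ∈ P := by
  rcases hP.cover (c * g) with h | h | h
  · exact h
  · exact absurd ((C.mul_mem_cancel_left hc).1 h) (hP.disjoint_left g hg)
  · have := hP.mul_mem _ hg _ h
    refine absurd (C.inv_mem hc) (hP.disjoint_left _ ?_)
    simpa using this

theorem mul_right_iff {g c : G} (hc : c ∈ C) : g * c ∈ P ↔ g ∈ P :=
  ⟨fun h => by simpa using hP.mul_mem_right h (C.inv_mem hc), fun h => hP.mul_mem_right h hc⟩

theorem mul_left_iff {g c : G} (hc : c ∈ C) : c * g ∈ P ↔ g ∈ P :=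
  ⟨fun h => by simpa using hP.mul_mem_left h (C.inv_mem hc), fun h => hP.mul_mem_left h hc⟩

theorem coneSign_mul_right (g : G) {c : G} (hc : c ∈ C) :
    coneSign P (g * c) = coneSign P g := by
  have h := hP.mul_left_iff (g := g⁻¹) (C.inv_mem hc)
  rw [← mul_inv_rev] at h
  have h' := hP.mul_right_iff (g := g) hc
  unfold coneSign
  split_ifs <;> tauto

theorem coneSign_mul_left (g : G) {c : G} (hc : c ∈ C) :
    coneSign P (c * g) = coneSign P g := by
  have h := hP.mul_right_iff (g := g⁻¹) (C.inv_mem hc)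
  rw [← mul_inv_rev] at h
  have h' := hP.mul_left_iff (g := g) hc
  unfold coneSign
  split_ifs <;> tauto

theorem coneSign_inv (g : G) : coneSign P g⁻¹ = -coneSign P g := by
  have := hP.disjoint_inv g
  have := hP.disjoint_inv g⁻¹
  simp only [coneSign, inv_inv] at *
  split_ifs <;> simp_all

theorem coneSign_of_inv_mem {g : G} (hg : g⁻¹ ∈ P) : coneSign P g = -1 := by
  have := hP.coneSign_inv g
  rw [coneSign_of_mem hg] at this
  omega

theorem odd_coneSign {g : G} (hg : g ∉ C) : Odd (coneSign P g) := by
  rcases hP.cover g with h | h | h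
  · simp [coneSign_of_mem h]
  · exact absurd h hg
  · simp [hP.coneSign_of_inv_mem h]

/-- Equal non-zero signs of `a` and `b` cancel. If they are opposite, `a⁻¹` and `b` have the same
sign, which is then that of `a⁻¹ * b`, leaving `±1`. If one of the elements lies in `C`, invariance
under `C` gives exactly `0`. -/
theorem abs_coneSign_sub_le (a b : G) :
    |coneSign P b - coneSign P a - coneSign P (a⁻¹ * b)| ≤ 1 := by
  have h0 : ∀ g, coneSign P g = 1 ∨ coneSign P g = -1 ∨ coneSign P g = 0 := by
    intro g
    unfold coneSign
    split_ifs <;> simp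
  have hpos : ∀ g, coneSign P g = 1 → g ∈ P := by
    intro g
    unfold coneSign
    split_ifs <;> simp_all
  have hneg : ∀ g, coneSign P g = -1 → g⁻¹ ∈ P := by
    intro g
    unfold coneSign
    split_ifs <;> simp_all
  have hzero : ∀ g, coneSign P g = 0 → g ∈ C := by
    intro g hg
    by_contra h
    simpa [hg] using hP.odd_coneSign h
  have hm : ∀ g h, coneSign P g = 1 → coneSign P h = 1 → coneSign P (g * h) = 1 :=
    fun g h hg hh => coneSign_of_mem (hP.mul_mem _ (hpos _ hg) _ (hpos _ hh))
  rcases h0 a with ha | ha | ha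
  · rcases h0 b with hb | hb | hb
    · rcases h0 (a⁻¹ * b) with h | h | h <;> simp [ha, hb, h]
    · have := hm b⁻¹ a (by rw [hP.coneSign_inv, hb]; rfl) ha
      have h := hP.coneSign_inv (b⁻¹ * a)
      simp only [mul_inv_rev, inv_inv, this] at h
      simp [ha, hb, h]
    · have h := hP.coneSign_mul_right a⁻¹ (hzero b hb)
      rw [hP.coneSign_inv] at h
      simp [ha, hb, h]
  · rcases h0 b with hb | hb | hb
    · have := hm a⁻¹ b (by rw [hP.coneSign_inv, ha]; rfl) hb
      simp [ha, hb, this]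
    · rcases h0 (a⁻¹ * b) with h | h | h <;> simp [ha, hb, h]
    · have h := hP.coneSign_mul_right a⁻¹ (hzero b hb)
      rw [hP.coneSign_inv] at h
      simp [ha, hb, h]
  · have h := hP.coneSign_mul_left b (C.inv_mem (hzero a ha))
    simp [ha, h]

end IsRelPositiveCone

/-- The contribution `±1` of two consecutive syllables to the quasi-morphism, where `n` orders the
factors. -/
def jump {ι : Type*} (n : ι → ℕ) : Option ι → Option ι → ℤ
  | some i, some j => ((n j : ℤ) - n i).sign
  | _, _ => 0

section Jump

variable {ι : Type*} (n : ι → ℕ)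

theorem jump_comm (o o' : Option ι) : jump n o o' = -jump n o' o := by
  rcases o with _ | i <;> rcases o' with _ | j <;> simp only [jump, neg_zero]
  rw [← Int.sign_neg, neg_sub]

@[simp] theorem jump_none_left (o : Option ι) : jump n none o = 0 := rfl

@[simp] theorem jump_self (o : Option ι) : jump n o o = 0 := by
  cases o <;> simp [jump]

/-- Three differences around a triangle add up to zero, so a repeated non-zero sign forces the third
to be opposite. If `none` occurs, at most one term survives. -/
theorem abs_jump_add_le (o k i : Option ι) :
    |jump n o k + jump n k i + jump n i o| ≤ 1 := by
  have h : ∀ x : ℤ, (x.sign = 1 ∧ 0 < x) ∨ (x.sign = 0 ∧ x = 0) ∨ (x.sign = -1 ∧ x < 0) := by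
    intro x
    rcases lt_trichotomy x 0 with h | h | h
    · exact Or.inr (Or.inr ⟨Int.sign_eq_neg_one_of_neg h, h⟩)
    · exact Or.inr (Or.inl ⟨by simp [h], h⟩)
    · exact Or.inl ⟨Int.sign_eq_one_of_pos h, h⟩
  rw [abs_le]
  rcases o with _ | o <;> rcases k with _ | k <;> rcases i with _ | i <;> simp only [jump]
  · omega
  · omega
  · omega
  · rcases h ((n i : ℤ) - n k) with h | h | h <;> omega
  · omega
  · rcases h ((n o : ℤ) - n i) with h | h | h <;> omega
  · rcases h ((n k : ℤ) - n o) with h | h | h <;> omega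
  · rcases h ((n i : ℤ) - n k) with h₁ | h₁ | h₁ <;>
      rcases h ((n o : ℤ) - n i) with h₂ | h₂ | h₂ <;>
      rcases h ((n k : ℤ) - n o) with h₃ | h₃ | h₃ <;> omega

theorem abs_jump_le (o k : Option ι) : |jump n o k| ≤ 1 := by
  simpa [jump_comm n k none] using abs_jump_add_le n o k none

theorem odd_jump (hn : Function.Injective n) {i j : ι} (h : i ≠ j) :
    Odd (jump n (some i) (some j)) := by
  have : n i ≠ n j := hn.ne h
  simp only [jump]
  rcases lt_or_gt_of_ne this with h | h
  · rw [Int.sign_eq_one_of_pos (by omega)]; exact odd_one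
  · rw [Int.sign_eq_neg_one_of_neg (by omega)]; exact odd_neg_one

end Jump

/-! ### Lists of syllables -/

section Syllables

variable {ι : Type*} {G : ι → Type*} [∀ i, Group (G i)]

/-- The sum of the signs of the syllables and of the jumps between consecutive syllables; `o` is
the index of the syllable before the list. -/
noncomputable def syllableSum (n : ι → ℕ) (P : ∀ i, Set (G i)) : Option ι → List (Σ i, G i) → ℤ
  | _, [] => 0
  | o, a :: l => jump n o (some a.1) + coneSign (P a.1) a.2 + syllableSum n P (some a.1) l

/-- The word `u⁻¹ w`. -/
def invAppend : List (Σ i, G i) → List (Σ i, G i) → List (Σ i, G i)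
  | [], w => w
  | a :: u, w => invAppend u (⟨a.1, a.2⁻¹⟩ :: w)

variable {H : Type*} [Group H] (φ : ∀ i, H →* G i)

/-- Consecutive syllables lie in different factors, and no syllable lies in the amalgamated
subgroup. -/
def IsReducedList (l : List (Σ i, G i)) : Prop :=
  l.IsChain (fun a b => a.1 ≠ b.1) ∧ ∀ a ∈ l, a.2 ∉ (φ a.1).range

/-- The element represented by a list of syllables. -/
def syllableProd (l : List (Σ i, G i)) : Monoid.PushoutI φ :=
  (l.map fun a => Monoid.PushoutI.of a.1 a.2).prod

variable {φ}

theorem isReducedList_nil : IsReducedList φ [] := ⟨.nil, by simp⟩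

theorem isReducedList_cons {a : Σ i, G i} {l : List (Σ i, G i)} :
    IsReducedList φ (a :: l) ↔
      (∀ b ∈ l.head?, a.1 ≠ b.1) ∧ a.2 ∉ (φ a.1).range ∧ IsReducedList φ l := by
  simp only [IsReducedList, List.isChain_cons, List.forall_mem_cons]
  tauto

@[simp] theorem syllableProd_nil : syllableProd φ [] = 1 := rfl

@[simp] theorem syllableProd_cons (a : Σ i, G i) (l : List (Σ i, G i)) :
    syllableProd φ (a :: l) = Monoid.PushoutI.of a.1 a.2 * syllableProd φ l := by
  simp [syllableProd]

theorem syllableProd_invAppend (u w : List (Σ i, G i)) :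
    syllableProd φ (invAppend u w) = (syllableProd φ u)⁻¹ * syllableProd φ w := by
  induction u generalizing w with
  | nil => simp [invAppend]
  | cons a u ih => simp [invAppend, ih, mul_assoc]

theorem isReducedList_invAppend {u w : List (Σ i, G i)} (hu : IsReducedList φ u)
    (hw : IsReducedList φ w) (h : ∀ a ∈ u.head?, ∀ b ∈ w.head?, a.1 ≠ b.1) :
    IsReducedList φ (invAppend u w) := by
  induction u generalizing w with
  | nil => exact hw
  | cons a u ih =>
    rw [isReducedList_cons] at hu
    refine ih hu.2.2 (isReducedList_cons.2 ⟨fun b hb => h a rfl b hb, ?_, hw⟩) ?_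
    · simpa using hu.2.1
    · intro b hb c hc
      simp only [List.head?_cons, Option.mem_def, Option.some.injEq] at hc
      subst hc
      exact (hu.1 b hb).symm

theorem invAppend_ne_nil {u w : List (Σ i, G i)} (h : u ≠ [] ∨ w ≠ []) :
    invAppend u w ≠ [] := by
  induction u generalizing w with
  | nil => simpa [invAppend] using h
  | cons a u ih => exact ih (by simp)

variable {n : ι → ℕ} {P : ∀ i, Set (G i)}

/-- Reading `u` backwards with inverted syllables negates every sign and every jump. The syllable
`a` is the pivot: its index precedes both `u` and `w`. -/
theorem syllableSum_invAppend_cons (hP : ∀ i, IsRelPositiveCone (φ i).range (P i))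
    (u w : List (Σ i, G i)) (a : Σ i, G i) :
    syllableSum n P none (invAppend u (a :: w)) =
      coneSign (P a.1) a.2 + syllableSum n P (some a.1) w - syllableSum n P (some a.1) u := by
  induction u generalizing w a with
  | nil => simp [invAppend, syllableSum]
  | cons b u ih =>
    simp only [invAppend, ih, syllableSum, (hP b.1).coneSign_inv]
    rw [jump_comm n (some b.1)]
    ring

/-- An element of the amalgamated subgroup can be moved to the right of a list of syllables. -/
theorem exists_base_mul_syllableProd (hP : ∀ i, IsRelPositiveCone (φ i).range (P i)) (c : H)
    {l : List (Σ i, G i)} (hl : IsReducedList φ l) :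
    ∃ l' c', IsReducedList φ l' ∧
      Monoid.PushoutI.base φ c * syllableProd φ l =
        syllableProd φ l' * Monoid.PushoutI.base φ c' ∧
      ∀ o, syllableSum n P o l' = syllableSum n P o l := by
  rcases l with _ | ⟨a, l⟩
  · exact ⟨[], c, hl, by simp, fun _ => rfl⟩
  -- The first syllable absorbs `c`; neither its index nor its sign changes.
  · refine ⟨⟨a.1, φ a.1 c * a.2⟩ :: l, 1, ?_, ?_, fun o => ?_⟩
    · rw [isReducedList_cons] at hl ⊢
      exact ⟨hl.1, fun h => hl.2.1 ((Subgroup.mul_mem_cancel_left _ (MonoidHom.mem_range.2 ⟨c, rfl⟩)).1 h), hl.2.2⟩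
    · simp [mul_assoc, Monoid.PushoutI.of_apply_eq_base]
    · simp [syllableSum, (hP a.1).coneSign_mul_left a.2 (c := φ a.1 c) ⟨c, rfl⟩]

/-- The quotient of the elements represented by two reduced lists. -/
theorem exists_inv_syllableProd_mul (hP : ∀ i, IsRelPositiveCone (φ i).range (P i))
    {u w : List (Σ i, G i)} (hu : IsReducedList φ u) (hw : IsReducedList φ w) (o : Option ι) :
    ∃ v c, IsReducedList φ v ∧
      (syllableProd φ u)⁻¹ * syllableProd φ w = syllableProd φ v * Monoid.PushoutI.base φ c ∧
      -- The common predecessor `o` is free so that a cancelled first syllable can take its place in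
      -- the induction. The clause on `v = []` will give well-definedness of the quasi-morphism.
      |syllableSum n P o w - syllableSum n P o u - syllableSum n P none v| ≤ 1 ∧
      (v = [] → ∀ o', syllableSum n P o' u = syllableSum n P o' w) := by
  induction u generalizing w o with
  | nil =>
    refine ⟨w, 1, hw, by simp, ?_, by rintro rfl _; rfl⟩
    rcases w with _ | ⟨b, w⟩
    · simp [syllableSum]
    · have := abs_jump_le n o (some b.1)
      simp only [syllableSum, jump_none_left]
      convert this using 2
      ring
  | cons a u ih =>
    rcases w with _ | ⟨b, w⟩
    · refine ⟨invAppend (a :: u) [], 1, isReducedList_invAppend hu hw (by simp), ?_, ?_,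
        fun h => absurd h (invAppend_ne_nil (by simp))⟩
      · simp [syllableProd_invAppend]
      · have := abs_jump_le n (some a.1) o
        rw [invAppend, syllableSum_invAppend_cons hP, (hP a.1).coneSign_inv]
        simp only [syllableSum]
        convert this using 2
        rw [jump_comm n o]
        ring
    · rw [isReducedList_cons] at hu hw
      by_cases hab : a.1 = b.1
      · obtain ⟨i, a⟩ := a
        obtain ⟨j, b⟩ := b
        obtain rfl : i = j := hab
        -- The first syllables agree modulo `C`: they cancel, and the discrepancy `c` is pushed into
        -- the rest of `w`. Otherwise the cancellation stops here and `a⁻¹ * b` becomes a syllable,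
        -- at the cost of a sign defect.
        by_cases hc : a⁻¹ * b ∈ (φ i).range
        · obtain ⟨c, hc⟩ := hc
          obtain rfl : b = a * φ i c := by rw [hc]; group
          obtain ⟨w', c', hw', hprod, hsum⟩ :=
            exists_base_mul_syllableProd (n := n) hP c hw.2.2
          obtain ⟨v, d, hv, h1, h2, h3⟩ := ih hu.2.2 hw' (some i)
          have hs := (hP i).coneSign_mul_right a (c := φ i c) ⟨c, rfl⟩
          refine ⟨v, d * c', hv, ?_, ?_, ?_⟩
          · rw [map_mul, ← mul_assoc, ← h1, mul_assoc, ← hprod]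
            simp [mul_assoc, Monoid.PushoutI.of_apply_eq_base]
          · rw [hsum] at h2
            simpa [syllableSum, hs] using h2
          · intro hv' o'
            simp [syllableSum, hs, h3 hv', hsum]
        · refine ⟨invAppend u (⟨i, a⁻¹ * b⟩ :: w), 1, ?_, ?_, ?_,
            fun h => absurd h (invAppend_ne_nil (by simp))⟩
          · refine isReducedList_invAppend hu.2.2 (isReducedList_cons.2 ⟨hw.1, hc, hw.2.2⟩) ?_
            intro x hx y hy
            simp only [List.head?_cons, Option.mem_def, Option.some.injEq] at hy
            subst hy
            exact (hu.1 x hx).symm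
          · simp [syllableProd_invAppend, mul_assoc]
          · have := (hP i).abs_coneSign_sub_le a b
            rw [syllableSum_invAppend_cons hP]
            simp only [syllableSum]
            convert this using 2
            ring
      -- Different factors meet, so nothing cancels; the defect is the sum of jumps around the
      -- triangle of `o`, `b.1` and `a.1`.
      · refine ⟨invAppend (a :: u) (b :: w), 1,
          isReducedList_invAppend (isReducedList_cons.2 hu) (isReducedList_cons.2 hw)
            (by simpa using hab), by simp [syllableProd_invAppend], ?_,
            fun h => absurd h (invAppend_ne_nil (by simp))⟩
        have := abs_jump_add_le n o (some b.1) (some a.1)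
        rw [syllableSum_invAppend_cons hP]
        simp only [syllableSum]
        convert this using 2
        rw [jump_comm n (some a.1) o]
        ring

end Syllables

/-! ### The quasi-morphism of an amalgamated free product -/

section Quasimorphism

variable {ι H : Type*} {G : ι → Type*} [Group H] [∀ i, Group (G i)] {φ : ∀ i, H →* G i}

/-- This is the normal form theorem for amalgams, which rests on the injectivity of the maps `φ i`.
-/
theorem IsReducedList.eq_nil_of_mem_range (hφ : ∀ i, Function.Injective (φ i))
    {l : List (Σ i, G i)} (hl : IsReducedList φ l)
    (h : syllableProd φ l ∈ (Monoid.PushoutI.base φ).range) : l = [] := by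
  let w : Monoid.CoprodI.Word G :=
    ⟨l, fun a ha h1 => hl.2 a ha (h1 ▸ Subgroup.one_mem _), hl.1⟩
  have hw : Monoid.PushoutI.Reduced φ w := hl.2
  have hprod : Monoid.PushoutI.ofCoprodI w.prod = syllableProd φ l := by
    simp [Monoid.CoprodI.Word.prod, map_list_prod, syllableProd, w, Function.comp_def]
  have := hw.eq_empty_of_mem_range hφ (hprod ▸ h)
  exact congrArg Monoid.CoprodI.Word.toList this

/-- A product `l m` is reduced by viewing it as the quotient of `l⁻¹` and `m`. Only the resulting
list matters, not the sums, so `n` is a dummy. -/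
theorem exists_isReducedList {P : ∀ i, Set (G i)} (hP : ∀ i, IsRelPositiveCone (φ i).range (P i))
    (g : Monoid.PushoutI φ) :
    ∃ l c, IsReducedList φ l ∧ g = syllableProd φ l * Monoid.PushoutI.base φ c := by
  induction g using Monoid.PushoutI.induction_on with
  | of i g =>
    by_cases h : g ∈ (φ i).range
    · obtain ⟨c, rfl⟩ := h
      exact ⟨[], c, isReducedList_nil, by simp [Monoid.PushoutI.of_apply_eq_base]⟩
    · exact ⟨[⟨i, g⟩], 1, isReducedList_cons.2 ⟨by simp, h, isReducedList_nil⟩, by simp⟩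
  | base h => exact ⟨[], h, isReducedList_nil, by simp⟩
  | mul x y hx hy =>
    obtain ⟨l, c, hl, rfl⟩ := hx
    obtain ⟨l', c', hl', rfl⟩ := hy
    obtain ⟨m, d, hm, hd, -⟩ := exists_base_mul_syllableProd (n := fun _ => 0) hP c hl'
    obtain ⟨v, e, hv, he, -, -⟩ := exists_inv_syllableProd_mul (n := fun _ => 0) hP
      (isReducedList_invAppend hl isReducedList_nil (by simp)) hm none
    refine ⟨v, e * d * c', hv, ?_⟩
    rw [syllableProd_invAppend] at he
    simp only [syllableProd_nil, mul_one, inv_inv] at he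
    calc _ = syllableProd φ l * (Monoid.PushoutI.base φ c * syllableProd φ l') *
          Monoid.PushoutI.base φ c' := by simp only [mul_assoc]
      _ = (syllableProd φ l * syllableProd φ m) * Monoid.PushoutI.base φ d *
          Monoid.PushoutI.base φ c' := by rw [hd]; simp only [mul_assoc]
      _ = _ := by rw [he]; simp only [map_mul, mul_assoc]

variable (φ) in
open Classical in
/-- The ordering quasi-morphism of an amalgamated free product: the sum of the signs of the
syllables and of the jumps of a reduced expression. -/
noncomputable def amalgamQuasi (n : ι → ℕ) (P : ∀ i, Set (G i)) (g : Monoid.PushoutI φ) : ℤ :=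
  if h : ∃ l c, IsReducedList φ l ∧ g = syllableProd φ l * Monoid.PushoutI.base φ c then
    -- The default is never taken once relative cones are given, by `exists_isReducedList`; the
    -- choice is harmless by `amalgamQuasi_apply`.
    syllableSum n P none h.choose else 0

variable {n : ι → ℕ} {P : ∀ i, Set (G i)}

/-- Two reduced expressions of one element have a quotient in the base group, so the list of that
quotient is empty and the sums agree. -/
theorem amalgamQuasi_apply (hφ : ∀ i, Function.Injective (φ i))
    (hP : ∀ i, IsRelPositiveCone (φ i).range (P i)) {l : List (Σ i, G i)}
    (hl : IsReducedList φ l) (c : H) :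
    amalgamQuasi φ n P (syllableProd φ l * Monoid.PushoutI.base φ c) = syllableSum n P none l := by
  have h : ∃ l' c', IsReducedList φ l' ∧ syllableProd φ l * Monoid.PushoutI.base φ c =
    syllableProd φ l' * Monoid.PushoutI.base φ c' := ⟨l, c, hl, rfl⟩
  rw [amalgamQuasi, dif_pos h]
  obtain ⟨c', hl', hc'⟩ := h.choose_spec
  generalize h.choose = l' at *
  obtain ⟨v, e, hv, he, -, hnil⟩ := exists_inv_syllableProd_mul (n := n) hP hl' hl none
  refine hnil (hv.eq_nil_of_mem_range hφ ⟨c' * c⁻¹ * e⁻¹, ?_⟩) none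
  rw [eq_mul_inv_iff_mul_eq.2 he.symm, eq_mul_inv_of_mul_eq hc']
  simp [mul_assoc]

/-- Each syllable with a predecessor contributes two odd numbers, its jump and its sign. In
`odd_syllableSum` the first syllable has no jump, whence the odd total. -/
theorem even_syllableSum (hn : Function.Injective n)
    (hP : ∀ i, IsRelPositiveCone (φ i).range (P i)) {l : List (Σ i, G i)}
    (hl : IsReducedList φ l) (i : ι) (hi : ∀ b ∈ l.head?, i ≠ b.1) :
    Even (syllableSum n P (some i) l) := by
  induction l generalizing i with
  | nil => simp [syllableSum]
  | cons a l ih =>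
    rw [isReducedList_cons] at hl
    exact ((odd_jump n hn (hi a rfl)).add_odd ((hP a.1).odd_coneSign hl.2.1)).add
      (ih hl.2.2 a.1 hl.1)

theorem odd_syllableSum (hn : Function.Injective n)
    (hP : ∀ i, IsRelPositiveCone (φ i).range (P i)) {l : List (Σ i, G i)}
    (hl : IsReducedList φ l) (h : l ≠ []) : Odd (syllableSum n P none l) := by
  rcases l with _ | ⟨a, l⟩
  · exact absurd rfl h
  · rw [isReducedList_cons] at hl
    simpa [syllableSum] using ((hP a.1).odd_coneSign hl.2.1).add_even
      (even_syllableSum hn hP hl.2.2 a.1 hl.1)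

theorem amalgamQuasi_inv (hφ : ∀ i, Function.Injective (φ i))
    (hP : ∀ i, IsRelPositiveCone (φ i).range (P i)) (g : Monoid.PushoutI φ) :
    amalgamQuasi φ n P g⁻¹ = -amalgamQuasi φ n P g := by
  obtain ⟨l, c, hl, rfl⟩ := exists_isReducedList hP g
  have hl' := isReducedList_invAppend hl isReducedList_nil (by simp)
  obtain ⟨m, d, hm, hd, hs⟩ := exists_base_mul_syllableProd (n := n) hP c⁻¹ hl'
  rw [mul_inv_rev, ← map_inv]
  have : (syllableProd φ l)⁻¹ = syllableProd φ (invAppend l []) := by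
    simp [syllableProd_invAppend]
  rw [this, hd, amalgamQuasi_apply hφ hP hm, amalgamQuasi_apply hφ hP hl, hs]
  rcases l with _ | ⟨a, l⟩
  · simp [invAppend, syllableSum]
  · rw [invAppend, syllableSum_invAppend_cons hP, (hP a.1).coneSign_inv]
    simp only [syllableSum, jump_none_left]
    ring

/-- With reduced expressions `u` of `g⁻¹` and `w` of `h`, the product `g * h` is `u⁻¹ w` up to
elements of the base, and `exists_inv_syllableProd_mul` applies. -/
theorem abs_amalgamQuasi_le (hφ : ∀ i, Function.Injective (φ i))
    (hP : ∀ i, IsRelPositiveCone (φ i).range (P i)) (g h : Monoid.PushoutI φ) :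
    |amalgamQuasi φ n P g + amalgamQuasi φ n P h - amalgamQuasi φ n P (g * h)| ≤ 1 := by
  obtain ⟨u, c, hu, hg⟩ := exists_isReducedList hP g⁻¹
  obtain ⟨w, d, hw, rfl⟩ := exists_isReducedList hP h
  obtain ⟨v, e, hv, he, hle, -⟩ := exists_inv_syllableProd_mul (n := n) hP hu hw none
  obtain ⟨m, f, hm, hf, hs⟩ := exists_base_mul_syllableProd (n := n) hP c⁻¹ hv
  have hgh : g * (syllableProd φ w * Monoid.PushoutI.base φ d) =
      syllableProd φ m * Monoid.PushoutI.base φ (f * e * d) := by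
    calc _ = Monoid.PushoutI.base φ c⁻¹ * ((syllableProd φ u)⁻¹ * syllableProd φ w) *
          Monoid.PushoutI.base φ d := by
            rw [← inv_inv g, hg]; simp [mul_assoc]
      _ = (Monoid.PushoutI.base φ c⁻¹ * syllableProd φ v) * Monoid.PushoutI.base φ e *
          Monoid.PushoutI.base φ d := by rw [he]; simp only [mul_assoc]
      _ = _ := by rw [hf]; simp only [map_mul, mul_assoc]
  have hτg : amalgamQuasi φ n P g = -syllableSum n P none u := by
    rw [← amalgamQuasi_apply hφ hP hu c, ← hg, amalgamQuasi_inv hφ hP, neg_neg]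
  rw [hgh, hτg, amalgamQuasi_apply hφ hP hm, amalgamQuasi_apply hφ hP hw, hs]
  convert hle using 2
  ring

theorem amalgamQuasi_eq_zero_iff (hn : Function.Injective n)
    (hφ : ∀ i, Function.Injective (φ i)) (hP : ∀ i, IsRelPositiveCone (φ i).range (P i))
    (g : Monoid.PushoutI φ) :
    amalgamQuasi φ n P g = 0 ↔ g ∈ (Monoid.PushoutI.base φ).range := by
  constructor
  · intro h
    obtain ⟨l, c, hl, rfl⟩ := exists_isReducedList hP g
    rw [amalgamQuasi_apply hφ hP hl] at h
    rcases eq_or_ne l [] with rfl | hne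
    · exact ⟨c, by simp⟩
    · simpa [h] using odd_syllableSum hn hP hl hne
  · rintro ⟨c, rfl⟩
    simpa [syllableSum] using amalgamQuasi_apply (n := n) hφ hP isReducedList_nil c

theorem isOrderingQuasimorphism_amalgamQuasi (hn : Function.Injective n)
    (hφ : ∀ i, Function.Injective (φ i)) (hP : ∀ i, IsRelPositiveCone (φ i).range (P i)) :
    IsOrderingQuasimorphism (amalgamQuasi φ n P) (Monoid.PushoutI.base φ).range where
  quasi := ⟨1, abs_amalgamQuasi_le hφ hP⟩
  kernel := amalgamQuasi_eq_zero_iff hn hφ hP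
  inv g := by rw [amalgamQuasi_inv hφ hP, neg_neg]
  le_one g h := by
    rw [amalgamQuasi_inv hφ hP]
    exact (abs_le.1 (abs_amalgamQuasi_le hφ hP g h)).2

theorem odd_or_amalgamQuasi_eq_zero (hn : Function.Injective n)
    (hφ : ∀ i, Function.Injective (φ i)) (hP : ∀ i, IsRelPositiveCone (φ i).range (P i))
    (g : Monoid.PushoutI φ) : Odd (amalgamQuasi φ n P g) ∨ amalgamQuasi φ n P g = 0 := by
  obtain ⟨l, c, hl, rfl⟩ := exists_isReducedList hP g
  rw [amalgamQuasi_apply hφ hP hl]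
  rcases eq_or_ne l [] with rfl | hne
  · exact Or.inr rfl
  · exact Or.inl (odd_syllableSum hn hP hl hne)

end Quasimorphism

/-! ### The relative positive cone of an ordering quasi-morphism. -/

namespace IsOrderingQuasimorphism

variable {G : Type*} [Group G] {τ : G → ℤ} {C : Subgroup G} (hτ : IsOrderingQuasimorphism τ C)
include hτ

/-- Integrality is essential: both values are at least `1`, and `τ (g * h)` is at least their sum
minus `1`. -/
theorem mul_pos {g h : G} (hg : 0 < τ g) (hh : 0 < τ h) : 0 < τ (g * h) := by
  have h1 := hτ.le_one g h
  have h2 := hτ.inv (g * h)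
  omega

theorem isRelPositiveCone : IsRelPositiveCone C {g | 0 < τ g} where
  mul_mem _ hg _ hh := hτ.mul_pos hg hh
  cover g := by
    have := hτ.inv g
    rcases lt_trichotomy (τ g) 0 with h | h | h
    · exact Or.inr (Or.inr (by simp only [Set.mem_ofPred_eq]; omega))
    · exact Or.inr (Or.inl ((hτ.kernel g).1 h))
    · exact Or.inl h
  disjoint_left g hg hC := by
    simp only [Set.mem_ofPred_eq, (hτ.kernel g).2 hC, lt_self_iff_false] at hg
  disjoint_inv g hg hg' := by
    have := hτ.inv g
    simp only [Set.mem_ofPred_eq] at hg hg'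
    omega

end IsOrderingQuasimorphism

/-! ### The transducer of an amalgamated free product -/

/-- States of the automaton reading words of syllables: `before o` between two syllables, the last
of which has index `o`; `inside i b q` in a syllable of index `i` and sign `b`; `tail` in the final
word over the generators of the amalgamated subgroup. -/
inductive SyllableState (ι : Type*) (σ : ι → Bool → Type)
  | before (o : Option ι)
  | inside (i : ι) (b : Bool) (q : σ i b)
  | tail

instance {ι : Type*} {σ : ι → Bool → Type} [Finite ι] [∀ i b, Finite (σ i b)] :
    Finite (SyllableState ι σ) := by
  let f : Option ι ⊕ (Σ i, Σ b, σ i b) ⊕ Unit → SyllableState ι σ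
    | .inl o => .before o
    | .inr (.inl s) => .inside s.1 s.2.1 s.2.2
    | .inr (.inr _) => .tail
  refine Finite.of_surjective f ?_
  rintro (o | ⟨i, b, q⟩ | _)
  · exact ⟨.inl o, rfl⟩
  · exact ⟨.inr (.inl ⟨i, b, q⟩), rfl⟩
  · exact ⟨.inr (.inr ()), rfl⟩

/-- The word of length at most one representing an integer in `{-1, 0, 1}`. -/
def signWord (x : ℤ) : List Bool := if 0 < x then [true] else if x < 0 then [false] else []

theorem evalInt_signWord {x : ℤ} (hx : |x| ≤ 1) : evalInt (signWord x) = x := by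
  rw [abs_le] at hx
  unfold signWord
  split_ifs <;> simp [evalInt] <;> omega

section SyllableAutomaton

variable {ι Y : Type*} {X : ι → Type*} {σ : ι → Bool → Type} (n : ι → ℕ)
  (M : ∀ i b, DFA (X i) (σ i b))

/-- The moves of the automaton reading words of syllables. -/
inductive SyllableEdge : SyllableState ι σ → List (Y ⊕ (Σ i, X i)) → List Bool →
    SyllableState ι σ → Prop
  -- The sign `b` of the coming syllable is guessed and written at once, after the jump; the
  -- automaton `M i b` then verifies the guess.
  | enter (o : Option ι) (i : ι) (b : Bool) : o ≠ some i →
      SyllableEdge (.before o) [] (signWord (jump n o (some i)) ++ [b]) (.inside i b (M i b).start)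
  | read (i : ι) (b : Bool) (q : σ i b) (x : X i) :
      SyllableEdge (.inside i b q) [.inr ⟨i, x⟩] [] (.inside i b ((M i b).step q x))
  | leave (i : ι) (b : Bool) (q : σ i b) : q ∈ (M i b).accept →
      SyllableEdge (.inside i b q) [] [] (.before (some i))
  | finish (o : Option ι) : SyllableEdge (.before o) [] [] .tail
  | readTail (y : Y) : SyllableEdge .tail [.inl y] [] .tail

/-- The graph of the automaton reading words of syllables. -/
def syllableGraph :
    Set (SyllableState ι σ × List (Y ⊕ (Σ i, X i)) × List Bool × SyllableState ι σ) :=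
  {e | SyllableEdge n M e.1 e.2.1 e.2.2.1 e.2.2.2}

theorem syllableGraph_finite [Finite ι] [Finite Y] [∀ i, Finite (X i)] [∀ i b, Finite (σ i b)] :
    (syllableGraph (Y := Y) n M).Finite := by
  have h1 := Set.finite_range fun e : Option ι × ι × Bool =>
    ((.before e.1, [], signWord (jump n e.1 (some e.2.1)) ++ [e.2.2],
      .inside e.2.1 e.2.2 (M e.2.1 e.2.2).start) :
      SyllableState ι σ × List (Y ⊕ (Σ i, X i)) × List Bool × SyllableState ι σ)
  have h2 := Set.finite_range fun e : Σ (i : ι) (b : Bool), σ i b × X i =>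
    ((.inside e.1 e.2.1 e.2.2.1, [.inr ⟨e.1, e.2.2.2⟩], [],
      .inside e.1 e.2.1 ((M e.1 e.2.1).step e.2.2.1 e.2.2.2)) :
      SyllableState ι σ × List (Y ⊕ (Σ i, X i)) × List Bool × SyllableState ι σ)
  have h3 := Set.finite_range fun e : Σ (i : ι) (b : Bool), σ i b =>
    ((.inside e.1 e.2.1 e.2.2, [], [], .before (some e.1)) :
      SyllableState ι σ × List (Y ⊕ (Σ i, X i)) × List Bool × SyllableState ι σ)
  have h4 := Set.finite_range fun o : Option ι =>
    ((.before o, [], [], .tail) :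
      SyllableState ι σ × List (Y ⊕ (Σ i, X i)) × List Bool × SyllableState ι σ)
  have h5 := Set.finite_range fun y : Y =>
    ((.tail, [.inl y], [], .tail) :
      SyllableState ι σ × List (Y ⊕ (Σ i, X i)) × List Bool × SyllableState ι σ)
  refine ((((h1.union h2).union h3).union h4).union h5).subset ?_
  rintro ⟨s, w, v, t⟩ h
  change SyllableEdge n M s w v t at h
  cases h with
  | enter o i b _ => exact Or.inl (Or.inl (Or.inl (Or.inl ⟨(o, i, b), rfl⟩)))
  | read i b q x => exact Or.inl (Or.inl (Or.inl (Or.inr ⟨⟨i, b, q, x⟩, rfl⟩)))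
  | leave i b q _ => exact Or.inl (Or.inl (Or.inr ⟨⟨i, b, q⟩, rfl⟩))
  | finish o => exact Or.inl (Or.inr ⟨o, rfl⟩)
  | readTail y => exact Or.inr ⟨y, rfl⟩

/-- The concatenation of a list of syllables. -/
def syllableConcat (l : List (Σ i, List (X i))) : List (Y ⊕ (Σ i, X i)) :=
  l.flatMap fun a => a.2.map fun x => Sum.inr ⟨a.1, x⟩

variable {G : ι → Type*} [∀ i, Group (G i)] (p : ∀ i, X i → G i)

/-- The elements represented by the syllables. -/
def syllableEval (l : List (Σ i, List (X i))) : List (Σ i, G i) :=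
  l.map fun a => ⟨a.1, eval (p a.1) a.2⟩

variable (P : ∀ i, Set (G i))

/-- `w` is a word of syllables following a syllable of index `o`, and `v` evaluates to its
syllable sum. -/
def IsSyllableReading (o : Option ι) (w : List (Y ⊕ (Σ i, X i))) (v : List Bool) : Prop :=
  ∃ (l : List (Σ i, List (X i))) (z : List Y), (∀ b ∈ l.head?, o ≠ some b.1) ∧
    l.IsChain (fun a b => a.1 ≠ b.1) ∧ (∀ a ∈ l, ∃ b, a.2 ∈ (M a.1 b).accepts) ∧
    w = syllableConcat l ++ z.map Sum.inl ∧
    evalInt v = syllableSum n P o (syllableEval p l)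

variable {n M p P}

/-- The induction on the path needs a statement for every starting state: from inside a syllable,
the rest of that syllable comes before a reading. -/
theorem isSyllableReading_of_wordPath (hp : ∀ i, ∀ w ∈ (M i true).accepts, eval (p i) w ∈ P i)
    (hm : ∀ i, ∀ w ∈ (M i false).accepts, coneSign (P i) (eval (p i) w) = -1)
    {s : SyllableState ι σ} {w : List (Y ⊕ (Σ i, X i))} {v : List Bool}
    (h : WordPath (syllableGraph n M) s w .tail v) :
    match (generalizing := false) s with
    | .before o => IsSyllableReading n M p P o w v
    | .inside i b q => ∃ u w', (M i b).evalFrom q u ∈ (M i b).accept ∧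
        w = (u.map fun x => Sum.inr ⟨i, x⟩) ++ w' ∧ IsSyllableReading n M p P (some i) w' v
    | .tail => ∃ z : List Y, w = z.map Sum.inl ∧ v = [] := by
  generalize ht : SyllableState.tail = t at h
  induction h with
  | refl => subst ht; exact ⟨[], rfl, rfl⟩
  | cons he _ ih =>
    replace ih := ih ht
    change SyllableEdge _ _ _ _ _ _ at he
    cases he with
    | enter o i b hne =>
      obtain ⟨u, w', hu, rfl, l, z, hl, hc, ha, rfl, hv⟩ := ih
      refine ⟨⟨i, u⟩ :: l, z, by simpa using hne, List.isChain_cons.2 ⟨fun c hc h => ?_, hc⟩, ?_,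
        by simp [syllableConcat], ?_⟩
      · exact hl c hc (congrArg some h)
      · rintro a (_ | ⟨_, ha'⟩)
        · exact ⟨b, hu⟩
        · exact ha a ha'
      · have hs : coneSign (P i) (eval (p i) u) = evalInt [b] := by
          cases b
          · exact hm i u hu
          · exact coneSign_of_mem (hp i u hu)
        rw [evalInt_append, List.append_eq, evalInt_append, hv, evalInt_signWord (abs_jump_le _ _ _), ← hs]
        rfl
    | read i b q x =>
      obtain ⟨u, w', hu, rfl, h⟩ := ih
      exact ⟨x :: u, w', hu, rfl, h⟩
    | leave i b q hq => exact ⟨[], _, hq, rfl, ih⟩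
    | finish o =>
      obtain ⟨z, rfl, rfl⟩ := ih
      exact ⟨[], z, by simp, .nil, by simp, rfl, rfl⟩
    | readTail y =>
      obtain ⟨z, rfl, rfl⟩ := ih
      exact ⟨y :: z, rfl, rfl⟩

theorem exists_wordPath_inside {i : ι} {b : Bool} (q : σ i b) {u : List (X i)}
    (hu : (M i b).evalFrom q u ∈ (M i b).accept) :
    WordPath (syllableGraph (Y := Y) n M) (.inside i b q) (u.map fun x => Sum.inr ⟨i, x⟩)
      (.before (some i)) [] := by
  induction u generalizing q with
  | nil => exact .single (SyllableEdge.leave i b q hu)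
  | cons x u ih => exact .cons (u := [_]) (v := []) (SyllableEdge.read i b q x) (ih _ hu)

theorem exists_wordPath_tail (z : List Y) :
    WordPath (syllableGraph n M) .tail (z.map Sum.inl) .tail [] := by
  induction z with
  | nil => exact .refl _
  | cons y z ih => exact .cons (u := [_]) (v := []) (SyllableEdge.readTail y) ih

theorem exists_wordPath_of_syllables (o : Option ι) {l : List (Σ i, List (X i))} (z : List Y)
    (ho : ∀ b ∈ l.head?, o ≠ some b.1) (hc : l.IsChain (fun a b => a.1 ≠ b.1))
    (ha : ∀ a ∈ l, ∃ b, a.2 ∈ (M a.1 b).accepts) :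
    ∃ v, WordPath (syllableGraph n M) (.before o) (syllableConcat l ++ z.map Sum.inl) .tail v := by
  induction l generalizing o with
  | nil =>
    exact ⟨_, .cons (u := []) (SyllableEdge.finish o) (exists_wordPath_tail z)⟩
  | cons a l ih =>
    rw [List.isChain_cons] at hc
    obtain ⟨v, hv⟩ := ih (some a.1) (fun b hb h => hc.1 b hb (Option.some.inj h)) hc.2
      fun c h => ha c (List.mem_cons_of_mem _ h)
    obtain ⟨b, hb⟩ := ha a List.mem_cons_self
    have h1 := (exists_wordPath_inside (n := n) (Y := Y) _ hb).trans hv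
    have he : (SyllableState.before o, ([] : List (Y ⊕ (Σ i, X i))), _, _) ∈ syllableGraph n M :=
      SyllableEdge.enter o a.1 b (ho a rfl)
    have h2 := WordPath.cons he h1
    exact ⟨_, by simpa [syllableConcat] using h2⟩

end SyllableAutomaton

theorem eval_append {G X : Type*} [Group G] (p : X → G) (u w : List X) :
    eval p (u ++ w) = eval p u * eval p w := by
  simp [eval]

section Amalgam

variable {ι H Y : Type*} {G X : ι → Type*} [Group H] [∀ i, Group (G i)]
  {φ : ∀ i, H →* G i} {p : ∀ i, X i → G i} {q : Y → H}

theorem eval_amalgamGens (l : List (Σ i, List (X i))) (z : List Y) :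
    eval (amalgamGens φ p q) (syllableConcat l ++ z.map Sum.inl) =
      syllableProd φ (syllableEval p l) * Monoid.PushoutI.base φ (eval q z) := by
  rw [eval_append]
  congr 1
  · induction l with
    | nil => rfl
    | cons a l ih =>
      have : syllableConcat (Y := Y) (a :: l) =
          (a.2.map fun x => Sum.inr ⟨a.1, x⟩) ++ syllableConcat l := by simp [syllableConcat]
      rw [this, eval_append, ih]
      simp [syllableEval, eval, map_list_prod, Function.comp_def, amalgamGens]
  · simp [eval, map_list_prod, Function.comp_def, amalgamGens]

theorem isReducedList_syllableEval {l : List (Σ i, List (X i))}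
    (hc : l.IsChain (fun a b => a.1 ≠ b.1))
    (h : ∀ a ∈ l, eval (p a.1) a.2 ∉ (φ a.1).range) : IsReducedList φ (syllableEval p l) := by
  refine ⟨by rwa [syllableEval, List.isChain_map], ?_⟩
  rintro a ha
  obtain ⟨b, hb, rfl⟩ := List.mem_map.1 ha
  exact h b hb

/-- The transducer computing the ordering quasi-morphism of an amalgamated free product. -/
theorem exists_tauTransducer_amalgam [Finite ι] [Finite Y] [∀ i, Finite (X i)]
    (hφ : ∀ i, Function.Injective (φ i)) (hp : ∀ i, IsGenerating (p i)) (hq : IsGenerating q)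
    {P : ∀ i, Set (G i)} (hP : ∀ i, IsRelPositiveCone (φ i).range (P i))
    {L : ∀ i, Language (X i)} (hL : ∀ i, (L i).IsRegular)
    (hLP : ∀ i, eval (p i) '' {w | w ∈ L i} = P i) :
    ∃ τ : Monoid.PushoutI φ → ℤ,
      IsOrderingQuasimorphism τ (Monoid.PushoutI.base φ).range ∧
      (∀ g, Odd (τ g) ∨ τ g = 0) ∧
      ∃ Lm : ∀ i, Language (X i),
        (∀ i, (Lm i).IsRegular ∧ eval (p i) '' {w | w ∈ Lm i} = {g | g⁻¹ ∈ P i}) ∧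
        ∃ (S : Type) (_ : Finite S) (T : Transducer S (Y ⊕ (Σ i, X i)) Bool),
          IsTauTransducer T (amalgamGens φ p q) τ ∧
          eval (amalgamGens φ p q) '' {w | w ∈ T.preimage posWords} = {g | 0 < τ g} ∧
          ∀ w, w ∈ T.preimage posWords ↔
            w ∈ syllableWords L Lm ∧ 0 < τ (eval (amalgamGens φ p q) w) := by
  obtain ⟨N, ⟨e⟩⟩ := Finite.exists_equiv_fin ι
  let n : ι → ℕ := fun i => e i
  have hn : Function.Injective n := fun i j h => e.injective (Fin.ext h)
  choose Lm hLm hLmP using fun i => exists_isRegular_inv (hp i) (hL i)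
  simp only [hLP] at hLmP
  -- The positive and the negative languages are joined into one family, so that `b` selects the
  -- automaton.
  have hreg : ∀ i (b : Bool), (if b then L i else Lm i).IsRegular := by
    rintro i (_ | _)
    · exact hLm i
    · exact hL i
  choose σ hσ M hM using hreg
  have hMt : ∀ i, (M i true).accepts = L i := fun i => hM i true
  have hMf : ∀ i, (M i false).accepts = Lm i := fun i => hM i false
  have hpos : ∀ i, ∀ w ∈ L i, eval (p i) w ∈ P i := fun i w hw => by
    rw [← hLP i]; exact ⟨w, hw, rfl⟩
  have hneg : ∀ i, ∀ w ∈ Lm i, (eval (p i) w)⁻¹ ∈ P i := fun i w hw => by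
    have : eval (p i) w ∈ eval (p i) '' {w | w ∈ Lm i} := ⟨w, hw, rfl⟩
    rwa [hLmP] at this
  have hacc : ∀ a : Σ i, List (X i),
      (∃ b, a.2 ∈ (M a.1 b).accepts) ↔ a.2 ∈ L a.1 ∨ a.2 ∈ Lm a.1 := by
    intro a
    rw [Bool.exists_bool, hMt, hMf, or_comm]
  have hred : ∀ l : List (Σ i, List (X i)), l.IsChain (fun a b => a.1 ≠ b.1) →
      (∀ a ∈ l, a.2 ∈ L a.1 ∨ a.2 ∈ Lm a.1) → IsReducedList φ (syllableEval p l) := by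
    intro l hc ha
    refine isReducedList_syllableEval hc fun a hal hr => ?_
    rcases ha a hal with h | h
    · exact (hP a.1).disjoint_left _ (hpos _ _ h) hr
    · exact (hP a.1).disjoint_left _ (hneg _ _ h) (inv_mem hr)
  obtain ⟨Q, hQ, T, -, hT⟩ := exists_transducer_of_wordPath
    (syllableGraph_finite (Y := Y) n M) (.before none) {.tail}
  -- Whatever the nondeterministic choices, the run spells out a reduced expression, and `τ` is the
  -- same for all of them.
  have hout : ∀ w v, v ∈ T.outputs w → w ∈ syllableWords L Lm ∧
      amalgamQuasi φ n P (eval (amalgamGens φ p q) w) = evalInt v := by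
    intro w v hv
    obtain ⟨t, rfl, h⟩ := (hT w v).1 hv
    obtain ⟨l, z, -, hc, ha, rfl, hs⟩ := isSyllableReading_of_wordPath (p := p) (P := P)
      (fun i w hw => hpos i w (hMt i ▸ hw))
      (fun i w hw => (hP i).coneSign_of_inv_mem (hneg i w (hMf i ▸ hw))) h
    simp only [hacc] at ha
    exact ⟨⟨l, z, hc, ha, rfl⟩,
      by rw [eval_amalgamGens, amalgamQuasi_apply hφ hP (hred l hc ha), hs]⟩
  have hin : ∀ w ∈ syllableWords (Y := Y) L Lm, ∃ v, v ∈ T.outputs w := by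
    rintro w ⟨l, z, hc, ha, rfl⟩
    simp only [← hacc] at ha
    obtain ⟨v, hv⟩ := exists_wordPath_of_syllables (n := n) none z (by simp) hc ha
    exact ⟨v, (hT _ _).2 ⟨_, rfl, hv⟩⟩
  have hsurj : ∀ g : Monoid.PushoutI φ, ∃ w ∈ syllableWords L Lm,
      eval (amalgamGens φ p q) w = g := by
    intro g
    obtain ⟨l, c, hl, rfl⟩ := exists_isReducedList hP g
    obtain ⟨z, rfl⟩ := hq c
    have hw : ∀ a ∈ l, ∃ w, (w ∈ L a.1 ∨ w ∈ Lm a.1) ∧ eval (p a.1) w = a.2 := by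
      intro a ha
      rcases (hP a.1).cover a.2 with h | h | h
      · rw [← hLP] at h
        obtain ⟨w, hw, h⟩ := h
        exact ⟨w, Or.inl hw, h⟩
      · exact absurd h (hl.2 a ha)
      · have : a.2 ∈ eval (p a.1) '' {w | w ∈ Lm a.1} := by rw [hLmP]; exact h
        obtain ⟨w, hw, h⟩ := this
        exact ⟨w, Or.inr hw, h⟩
    have : ∃ l' : List (Σ i, List (X i)), syllableEval p l' = l ∧
        ∀ a ∈ l', a.2 ∈ L a.1 ∨ a.2 ∈ Lm a.1 := by
      clear hl
      induction l with
      | nil => exact ⟨[], rfl, by simp⟩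
      | cons a l ih =>
        obtain ⟨l', rfl, h⟩ := ih fun b hb => hw b (List.mem_cons_of_mem _ hb)
        obtain ⟨w, hw, h'⟩ := hw a List.mem_cons_self
        exact ⟨⟨a.1, w⟩ :: l', by simp [syllableEval, h'], by simpa using ⟨hw, h⟩⟩
    obtain ⟨l', rfl, hl'⟩ := this
    have hc := hl.1
    rw [syllableEval, List.isChain_map] at hc
    exact ⟨_, ⟨l', z, hc, hl', rfl⟩, eval_amalgamGens l' z⟩
  have hpre : ∀ w, w ∈ T.preimage posWords ↔
      w ∈ syllableWords L Lm ∧ 0 < amalgamQuasi φ n P (eval (amalgamGens φ p q) w) := by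
    intro w
    constructor
    · rintro ⟨v, hv, ho⟩
      obtain ⟨h1, h2⟩ := hout w v ho
      exact ⟨h1, h2 ▸ (mem_posWords_iff v).1 hv⟩
    · rintro ⟨hw, h⟩
      obtain ⟨v, hv⟩ := hin w hw
      exact ⟨v, (mem_posWords_iff v).2 ((hout w v hv).2 ▸ h), hv⟩
  refine ⟨amalgamQuasi φ n P, isOrderingQuasimorphism_amalgamQuasi hn hφ hP,
    odd_or_amalgamQuasi_eq_zero hn hφ hP, Lm, fun i => ⟨hLm i, hLmP i⟩, Q, hQ, T,
    ⟨fun g => ?_, fun w v hv => (hout w v hv).2⟩, ?_, hpre⟩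
  · obtain ⟨w, hw, rfl⟩ := hsurj g
    exact ⟨w, hin w hw, rfl⟩
  · ext g
    constructor
    · rintro ⟨w, hw, rfl⟩
      exact ((hpre w).1 hw).2
    · intro hg
      obtain ⟨w, hw, rfl⟩ := hsurj g
      exact ⟨w, (hpre w).2 ⟨hw, hg⟩, rfl⟩

end Amalgam

/-! ### Changing the generating set -/

namespace Transducer

variable {S X X' Y : Type*}

/-- The transducer reading `f x` in place of `x`. -/
def comap (T : Transducer S X Y) (f : X' → X) : Transducer S X' Y where
  step s x := T.step s (x.map f)
  start := T.start
  accept := T.accept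

theorem run_comap (T : Transducer S X Y) (f : X' → X) {s t : S} {w : List X'} {v : List Y} :
    (T.comap f).Run s w t v ↔ T.Run s (w.map f) t v := by
  constructor
  · intro h
    induction h with
    | refl => exact .refl _
    | @move s s' s'' x w u v he _ ih =>
      have : (x.toList ++ w).map f = (x.map f).toList ++ w.map f := by cases x <;> simp
      exact this ▸ .move he ih
  · intro h
    generalize hw : w.map f = w' at h
    induction h generalizing w with
    | refl =>
      obtain rfl := List.map_eq_nil_iff.1 hw
      exact .refl _
    | @move s s' s'' x w' u v he _ ih =>
      rcases x with _ | x
      · exact Run.move (T := T.comap f) (x := none) he (ih hw)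
      · rcases w with _ | ⟨a, w⟩
        · simp at hw
        · simp only [List.map_cons, Option.toList_some, List.cons_append, List.nil_append,
            List.cons.injEq] at hw
          obtain ⟨rfl, hw⟩ := hw
          exact Run.move (T := T.comap f) (x := some a) he (ih hw)

theorem mem_outputs_comap (T : Transducer S X Y) (f : X' → X) (w : List X') (v : List Y) :
    v ∈ (T.comap f).outputs w ↔ v ∈ T.outputs (w.map f) := by
  constructor <;> rintro ⟨s, hs, h⟩
  · exact ⟨s, hs, (T.run_comap f).1 h⟩
  · exact ⟨s, hs, (T.run_comap f).2 h⟩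

theorem mem_preimage_comap (T : Transducer S X Y) (f : X' → X) (L : Language Y) (w : List X') :
    w ∈ (T.comap f).preimage L ↔ w.map f ∈ T.preimage L :=
  exists_congr fun v => and_congr_right fun _ => T.mem_outputs_comap f w v

end Transducer

section Transport

variable {G G' X X' : Type*} [Group G] [Group G']

theorem map_eval (f : G →* G') (p : X → G) (w : List X) : f (eval p w) = eval (f ∘ p) w := by
  simp [eval, map_list_prod]

theorem eval_map (p : X → G) (f : X' → X) (w : List X') : eval p (w.map f) = eval (p ∘ f) w := by
  simp [eval]

theorem eval_flatMap {p : X → G} {r : X' → G} {c : X → List X'} (hc : ∀ x, eval r (c x) = p x)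
    (w : List X) : eval r (w.flatMap c) = eval p w := by
  induction w with
  | nil => rfl
  | cons x w ih =>
    rw [List.flatMap_cons, eval_append, ih, hc]
    simp [eval]

theorem IsOrderingQuasimorphism.comp {τ : G' → ℤ} {C : Subgroup G'}
    (hτ : IsOrderingQuasimorphism τ C) (f : G →* G') :
    IsOrderingQuasimorphism (fun g => τ (f g)) (C.comap f) where
  quasi := hτ.quasi.imp fun D hD g h => by simpa using hD (f g) (f h)
  kernel g := hτ.kernel (f g)
  inv g := by simpa using hτ.inv (f g)
  le_one g h := by simpa using hτ.le_one (f g) (f h)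

theorem IsLeftOrder.isRelPositiveCone {lt : G → G → Prop} (h : IsLeftOrder lt) :
    IsRelPositiveCone ⊥ (positiveCone lt) where
  mul_mem a ha b hb := by
    refine h.trans 1 a (a * b) ha ?_
    simpa using (h.mul_left 1 b a).1 hb
  cover a := by
    rcases h.total 1 a with h1 | h1 | h1
    · exact Or.inl h1
    · exact Or.inr (Or.inl (Subgroup.mem_bot.2 h1.symm))
    · exact Or.inr (Or.inr (by simpa [positiveCone] using (h.mul_left a 1 a⁻¹).1 h1))
  disjoint_left a ha h1 := by
    obtain rfl := Subgroup.mem_bot.1 h1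
    exact h.irrefl 1 ha
  disjoint_inv a ha ha' := by
    have : lt a 1 := by simpa using (h.mul_left 1 a⁻¹ a).1 ha'
    exact h.irrefl 1 (h.trans _ _ _ ha this)

theorem IsRelPositiveCone.isLeftOrder {P : Set G} (hP : IsRelPositiveCone ⊥ P) :
    IsLeftOrder fun a b => a⁻¹ * b ∈ P where
  irrefl a h := hP.disjoint_left _ h (by simp)
  trans a b c hab hbc := by simpa [mul_assoc] using hP.mul_mem _ hab _ hbc
  total a b := by
    rcases hP.cover (a⁻¹ * b) with h | h | h
    · exact Or.inl h
    · exact Or.inr (Or.inl (inv_mul_eq_one.1 (Subgroup.mem_bot.1 h)))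
    · exact Or.inr (Or.inr (by simpa using h))
  mul_left a b c := by simp [mul_assoc]

theorem IsRelPositiveCone.image_mulEquiv {P : Set G} (hP : IsRelPositiveCone ⊥ P) (e : G ≃* G') :
    IsRelPositiveCone ⊥ (e '' P) := by
  have h : ∀ g, g ∈ e '' P ↔ e.symm g ∈ P := fun g => by
    constructor
    · rintro ⟨x, hx, rfl⟩
      simpa using hx
    · exact fun hg => ⟨_, hg, by simp⟩
  constructor
  · intro a ha b hb
    rw [h] at ha hb ⊢
    simpa using hP.mul_mem _ ha _ hb
  · intro a
    simpa [h] using hP.cover (e.symm a)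
  · intro a ha h1
    obtain rfl := Subgroup.mem_bot.1 h1
    rw [h] at ha
    exact hP.disjoint_left _ ha (by simp)
  · intro a ha ha'
    rw [h] at ha ha'
    exact hP.disjoint_inv _ ha (by simpa using ha')

theorem IsGenerating.transport {p : X → G} (hp : IsGenerating p) (e : G ≃* G') (f : X ≃ X') :
    IsGenerating (fun x => e (p (f.symm x))) := by
  intro g
  obtain ⟨w, hw⟩ := hp (e.symm g)
  refine ⟨w.map f, ?_⟩
  rw [eval_map]
  have := map_eval e.toMonoidHom p w
  rw [hw] at this
  simpa [Function.comp_def] using this.symm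

theorem exists_isRegular_transport {p : X → G} {L : Language X} (hL : L.IsRegular) (e : G ≃* G')
    (f : X ≃ X') : ∃ L' : Language X', L'.IsRegular ∧
      eval (fun x => e (p (f.symm x))) '' {w | w ∈ L'} = e '' (eval p '' {w | w ∈ L}) := by
  obtain ⟨σ, hσ, M, rfl⟩ := hL
  refine ⟨_, ⟨σ, hσ, M.comap f.symm, rfl⟩, ?_⟩
  rw [DFA.accepts_comap, Set.image_image]
  have key : ∀ w, eval (fun x => e (p (f.symm x))) w = e (eval p (w.map f.symm)) := fun w => by
    rw [eval_map]
    exact (map_eval e.toMonoidHom _ w).symm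
  ext g
  constructor
  · rintro ⟨w, hw, rfl⟩
    exact ⟨w.map f.symm, hw, (key w).symm⟩
  · rintro ⟨w, hw, rfl⟩
    refine ⟨w.map f, ?_, ?_⟩
    · change (w.map f).map f.symm ∈ M.accepts
      simpa using hw
    · simp [key]

end Transport

/-! ### Free products of two groups -/

/-- The free product of two groups as a pushout over the trivial group. -/
def coprodEquivPushout {A B : Type*} {G : Bool → Type*} [Group A] [Group B] [∀ b, Group (G b)]
    (eA : A ≃* G true) (eB : B ≃* G false) :
    Monoid.Coprod A B ≃* Monoid.PushoutI (fun b => (1 : PUnit.{1} →* G b)) :=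
  MonoidHom.toMulEquiv
    (Monoid.Coprod.lift ((Monoid.PushoutI.of true).comp eA.toMonoidHom)
      ((Monoid.PushoutI.of false).comp eB.toMonoidHom))
    (Monoid.PushoutI.lift
      (fun b => match b with
        | true => Monoid.Coprod.inl.comp eA.symm.toMonoidHom
        | false => Monoid.Coprod.inr.comp eB.symm.toMonoidHom) 1 (by rintro (_ | _) <;> ext <;> simp))
    (by ext x <;> simp)
    (by
      refine Monoid.PushoutI.hom_ext ?_ (by ext x; obtain rfl : x = 1 := rfl; rw [map_one, map_one])
      rintro (_ | _) <;> ext x <;> simp)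

/-- The ordering quasi-morphism and the transducer of a free product of two groups. -/
theorem exists_tauTransducer_coprod {A B X Y : Type*} {G X' : Bool → Type*} [Group A] [Group B]
    [Finite X] [Finite Y] [∀ b, Group (G b)] (eA : A ≃* G true) (eB : B ≃* G false)
    (fX : X ≃ X' true) (fY : Y ≃ X' false) {p : X → A} (hp : IsGenerating p) {q : Y → B}
    (hq : IsGenerating q) {P : Set A} (hP : IsRelPositiveCone ⊥ P) {Q : Set B}
    (hQ : IsRelPositiveCone ⊥ Q) {L : Language X} (hL : L.IsRegular)
    (hLP : eval p '' {w | w ∈ L} = P) {K : Language Y} (hK : K.IsRegular)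
    (hKQ : eval q '' {w | w ∈ K} = Q) :
    ∃ τ : Monoid.Coprod A B → ℤ,
      IsOrderingQuasimorphism τ ⊥ ∧ (∀ g, Odd (τ g) ∨ τ g = 0) ∧
      ∃ (S : Type) (_ : Finite S) (T : Transducer S (X ⊕ Y) Bool),
        IsTauTransducer T (coprodGens p q) τ ∧
        eval (coprodGens p q) '' {w | w ∈ T.preimage posWords} = {g | 0 < τ g} := by
  -- A pushout needs its factors in one universe, so both groups and alphabets are first carried
  -- into families over `Bool`.
  obtain ⟨L', hL', hLP'⟩ := exists_isRegular_transport (p := p) hL eA fX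
  obtain ⟨K', hK', hKQ'⟩ := exists_isRegular_transport (p := q) hK eB fY
  rw [hLP] at hLP'
  rw [hKQ] at hKQ'
  let φ : ∀ b, PUnit.{1} →* G b := fun _ => 1
  have hrange : ∀ b, (φ b).range = ⊥ := fun b => MonoidHom.range_one
  let p' : ∀ b, X' b → G b
    | true => fun x => eA (p (fX.symm x))
    | false => fun x => eB (q (fY.symm x))
  let P' : ∀ b, Set (G b)
    | true => eA '' P
    | false => eB '' Q
  let M : ∀ b, Language (X' b)
    | true => L'
    | false => K'
  -- The trivial group is generated by no letters, so the final word over the amalgamated subgroup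
  -- is always empty.
  let q' : Empty → PUnit.{1} := Empty.elim
  have hfin : ∀ b, Finite (X' b) := by
    rintro (_ | _)
    · exact .of_equiv _ fY
    · exact .of_equiv _ fX
  have hp' : ∀ b, IsGenerating (p' b) := by
    rintro (_ | _)
    · exact hq.transport eB fY
    · exact hp.transport eA fX
  have hP' : ∀ b, IsRelPositiveCone (φ b).range (P' b) := by
    intro b
    rw [hrange]
    rcases b with _ | _
    · exact hQ.image_mulEquiv eB
    · exact hP.image_mulEquiv eA
  have hM : ∀ b, (M b).IsRegular := by
    rintro (_ | _)
    · exact hK'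
    · exact hL'
  have hMP : ∀ b, eval (p' b) '' {w | w ∈ M b} = P' b := by
    rintro (_ | _)
    · exact hKQ'
    · exact hLP'
  obtain ⟨τ, hτ, hodd, -, -, S, hS, T, hT, himage, -⟩ := exists_tauTransducer_amalgam
    (fun b _ _ _ => rfl) hp' (q := q') (fun _ => ⟨[], rfl⟩) hP' hM hMP
  let e := coprodEquivPushout eA eB
  let f : X ⊕ Y ≃ Empty ⊕ (Σ b, X' b) :=
    { toFun := Sum.elim (fun x => .inr ⟨true, fX x⟩) (fun y => .inr ⟨false, fY y⟩)
      invFun := Sum.elim Empty.elim fun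
        | ⟨true, x⟩ => .inl (fX.symm x)
        | ⟨false, y⟩ => .inr (fY.symm y)
      left_inv := by rintro (x | y) <;> simp
      right_inv := by rintro (⟨⟨⟩⟩ | ⟨_ | _, x⟩) <;> simp }
  have hgen : ∀ x, e (coprodGens p q x) = amalgamGens φ p' q' (f x) := by
    rintro (x | y) <;>
      simp [e, f, p', coprodGens, amalgamGens, coprodEquivPushout, φ]
  have heval : ∀ w, e (eval (coprodGens p q) w) = eval (amalgamGens φ p' q') (w.map f) := by
    intro w
    rw [eval_map]
    refine (map_eval e.toMonoidHom _ w).trans ?_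
    congr 1
    exact funext hgen
  have heval' : ∀ w, e.symm (eval (amalgamGens φ p' q') w) =
      eval (coprodGens p q) (w.map f.symm) := by
    intro w
    rw [MulEquiv.symm_apply_eq, heval]
    simp
  refine ⟨fun g => τ (e g), ?_, fun g => hodd (e g), S, hS, T.comap f, ⟨fun g => ?_, ?_⟩, ?_⟩
  · suffices h : (⊥ : Subgroup (Monoid.Coprod A B)) =
        (Monoid.PushoutI.base φ).range.comap e.toMonoidHom from h ▸ hτ.comp e.toMonoidHom
    ext g
    simp only [Subgroup.mem_bot, Subgroup.mem_comap]
    constructor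
    · rintro rfl
      simp
    · rintro ⟨c, hc⟩
      obtain rfl : c = 1 := rfl
      rw [map_one] at hc
      exact (map_eq_one_iff e e.injective).1 hc.symm
  · obtain ⟨w, ⟨v, hv⟩, hw⟩ := hT.surj (e g)
    refine ⟨w.map f.symm, ⟨v, ?_⟩, ?_⟩
    · rw [Transducer.mem_outputs_comap]
      simpa using hv
    · rw [← heval', hw, MulEquiv.symm_apply_apply]
  · intro w v hv
    rw [Transducer.mem_outputs_comap] at hv
    rw [heval]
    exact hT.compute _ _ hv
  · ext g
    have hg : e g ∈ eval (amalgamGens φ p' q') '' {w | w ∈ T.preimage posWords} ↔ 0 < τ (e g) := by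
      rw [himage]
      rfl
    refine Iff.trans ?_ hg
    constructor
    · rintro ⟨w, hw, rfl⟩
      exact ⟨w.map f, (T.mem_preimage_comap f _ w).1 hw, (heval w).symm⟩
    · rintro ⟨w, hw, h⟩
      refine ⟨w.map f.symm, (T.mem_preimage_comap f _ _).2 (by simpa using hw), ?_⟩
      rw [← heval', h, MulEquiv.symm_apply_apply]

/-- The type family over `Bool` with values `B` and `A` in a common universe. -/
abbrev boolFamily.{u, v} (A : Type u) (B : Type v) : Bool → Type (max u v)
  | true => ULift.{v} A
  | false => ULift.{u} B

instance {A B : Type*} [Group A] [Group B] : ∀ b, Group (boolFamily A B b)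
  | true => inferInstanceAs (Group (ULift A))
  | false => inferInstanceAs (Group (ULift B))

end LeftOrderLang

/-! ### Assembly of both statements and passage to arbitrary generating sets. -/

open LeftOrderLang
theorem mainTheorem9 :
    -- amalgamated free products of finitely many groups
    (∀ {ι H Y : Type*} {G X : ι → Type*} [Finite ι] [Group H] [Finite Y]
      [∀ i, Group (G i)] [∀ i, Finite (X i)]
      (φ : ∀ i, H →* G i) (_ : ∀ i, Function.Injective (φ i))
      (p : ∀ i, X i → G i) (_ : ∀ i, IsGenerating (p i))
      (q : Y → H) (_ : IsGenerating q)
      (P : ∀ i, Set (G i)) (_ : ∀ i, IsRelPositiveCone (φ i).range (P i))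
      (L : ∀ i, Language (X i)) (_ : ∀ i, (L i).IsRegular)
      (_ : ∀ i, eval (p i) '' {w | w ∈ L i} = P i),
      ∃ τ : Monoid.PushoutI φ → ℤ,
        IsOrderingQuasimorphism τ (Monoid.PushoutI.base φ).range ∧
        (∀ g, Odd (τ g) ∨ τ g = 0) ∧
        ∃ Lm : ∀ i, Language (X i),
          (∀ i, (Lm i).IsRegular ∧ eval (p i) '' {w | w ∈ Lm i} = {g | g⁻¹ ∈ P i}) ∧
          ∃ (S : Type) (_ : Finite S) (T : Transducer S (Y ⊕ (Σ i, X i)) Bool),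
            IsTauTransducer T (amalgamGens φ p q) τ ∧
            IsRelPositiveCone (Monoid.PushoutI.base φ).range
              (eval (amalgamGens φ p q) '' {w | w ∈ T.preimage posWords}) ∧
            ∀ w, w ∈ T.preimage posWords ↔
              w ∈ syllableWords L Lm ∧ 0 < τ (eval (amalgamGens φ p q) w)) ∧
    -- free products of two groups
    (∀ {A B X Y : Type*} [Group A] [Group B] [Finite X] [Finite Y]
      (p : X → A) (_ : IsGenerating p) (q : Y → B) (_ : IsGenerating q)
      (ltA : A → A → Prop) (_ : IsLeftOrderOfClass Language.IsRegular p ltA)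
      (ltB : B → B → Prop) (_ : IsLeftOrderOfClass Language.IsRegular q ltB),
      ∃ τ : Monoid.Coprod A B → ℤ,
        IsOrderingQuasimorphism τ ⊥ ∧ (∀ g, Odd (τ g) ∨ τ g = 0) ∧
        (∃ (S : Type) (_ : Finite S) (T : Transducer S (X ⊕ Y) Bool),
          IsTauTransducer T (coprodGens p q) τ ∧
          IsOneCounter (T.preimage posWords) ∧
          eval (coprodGens p q) '' {w | w ∈ T.preimage posWords} = {g | 0 < τ g}) ∧
        ∃ lt : Monoid.Coprod A B → Monoid.Coprod A B → Prop,
          IsLeftOrder lt ∧ positiveCone lt = {g | 0 < τ g} ∧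
          ∀ {Z : Type*} [Finite Z] (r : Z → Monoid.Coprod A B), IsGenerating r →
            IsLeftOrderOfClass IsOneCounter r lt) := by
  constructor
  · intro ι H Y G X _ _ _ _ _ φ hφ p hp q hq P hP L hL hLP
    obtain ⟨τ, hτ, hodd, Lm, hLm, S, hS, T, hT, himage, hpre⟩ :=
      exists_tauTransducer_amalgam hφ hp hq hP hL hLP
    exact ⟨τ, hτ, hodd, Lm, hLm, S, hS, T, hT, himage ▸ hτ.isRelPositiveCone, hpre⟩
  · intro A B X Y _ _ _ _ p hp q hq ltA hA ltB hB
    obtain ⟨hltA, L, hL, hLP⟩ := hA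
    obtain ⟨hltB, K, hK, hKQ⟩ := hB
    obtain ⟨τ, hτ, hodd, S, hS, T, hT, himage⟩ := exists_tauTransducer_coprod
      (G := boolFamily A B) (X' := boolFamily X Y) (MulEquiv.ulift (α := A)).symm
      (MulEquiv.ulift (α := B)).symm Equiv.ulift.symm Equiv.ulift.symm hp hq
      hltA.isRelPositiveCone hltB.isRelPositiveCone hL hLP hK hKQ
    have hpos : positiveCone (fun a b : Monoid.Coprod A B => a⁻¹ * b ∈ {g | 0 < τ g}) =
        {g | 0 < τ g} := by
      ext g
      simp [positiveCone]
    refine ⟨τ, hτ, hodd, ⟨S, hS, T, hT, T.isOneCounter_preimage_posWords, himage⟩,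
      fun a b => a⁻¹ * b ∈ {g | 0 < τ g}, hτ.isRelPositiveCone.isLeftOrder, hpos, ?_⟩
    intro Z _ r hr
    -- Each standard generator is spelled as a word over `Z`; substituting these words keeps the
    -- language one-counter and its evaluation unchanged.
    choose c hc using fun x => hr (coprodGens p q x)
    refine ⟨hτ.isRelPositiveCone.isLeftOrder, _, T.isOneCounter_preimage_posWords_image c, ?_⟩
    rw [hpos, ← himage]
    ext g
    constructor
    · rintro ⟨_, ⟨w, hw, rfl⟩, rfl⟩
      exact ⟨w, hw, (eval_flatMap hc w).symm⟩
    · rintro ⟨w, hw, rfl⟩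
      exact ⟨_, ⟨w, hw, rfl⟩, eval_flatMap hc w⟩
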